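/- All Banach spaces are real. Let $E$ be a Banach space with a normalized Schauder basis $(e_j)_{j\ge1}$, biorthogonal functionals $(e_j^*)_{j\ge 1}$ and basis constant $\lambda=\sup_n\|P_n\|$, where $P_nx=\sum_{j\le n}\langle e_j^*,x\rangle e_j$. Let $C_r,C\ge 1$. **Definitions.** For a Banach space $Z$ let $\mathcal B(Z)$ be the algebra of bounded linear operators on $Z$. For $S,T\in\mathcal B(Z)$ we say that $S$ *factors through $T$ with constant $K^+$* if for every $\gamma>0$ there are $A,B\in\mathcal B(Z)$ with $S=ATB$ and $\|A\|\|B\|\le K+\gamma$. The space $Z$ has the *$K$-primary factorization property* if for every $T\in\mathcal B(Z)$ the identity $I_Z$ factors through $T$ or through $I_Z-T$ with constant $K^+$. The space $E$ has the *$K$-primary diagonal factorization property* with respect to $(e_j)$ if this holds for all $T\in\mathcal B(E)$ that are diagonal, i.e. $\langle e_k^*,Te_j\rangle=0$ for $k\neq j$. Put $\mathcal M_Z=\{T\in\mathcal B(Z): I_Z\ne ATB\text{ for all }A,B\in\mathcal B(Z)\}$. The space $Z$ is *primary* if whenever $Z=F\oplus G$ with closed subspaces $F,G$, then $F$ or $G$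 is isomorphic to $Z$. The space $E$ is *asymptotically curved* with respect to $(e_j)$ if $\lim_n\frac1n\|\sum_{j=1}^n x_j\|=0$ for every bounded block basis $(x_j)$ of $(e_j)$. Two sequences $(x_k)$, $(y_k)$ in normed spaces are *impartially $K$-equivalent* if $\frac1{\sqrt K}\|\sum a_ky_k\|\le\|\sum a_kx_k\|\le\sqrt K\|\sum a_ky_k\|$ for all finitely supported real sequences $(a_k)$. The basis $(e_j)$ is *$C_r$-strategically reproducible in $E$ with projectional factors* if for every $\eta>0$ player (II) has a winning strategy in the following infinite game. First, player (I) chooses a partition $\mathbb N=N_1\cup N_2$ (one of the sets may be empty). In turn $k=1,2,\dots$: player (I) chooses $\eta_k>0$, a closed subspace $W_k\subset E$ of finite codimension and a weak* closed subspace $G_k\subset E^*$ of finite codimension; then player (II) chooses $i_k\in\{1,2\}$, a finite set $E_k\subset N_{i_k}$ and non-negative reals $(\lambda^k_j)_{j\in E_k}$, $(\mu^k_j)_{j\in E_k}$ with $1-\eta<\sum_{j\in E_k}\lambda^k_j\mu^k_j<1+\eta$; then player (I) chooses signs $(\varepsilon^k_j)_{j\in E_k}\in\{\pm1\}^{E_k}$.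 Put $x_k=\sum_{j\in E_k}\varepsilon^k_j\lambda^k_je_j$ and $x_k^*=\sum_{j\in E_k}\varepsilon^k_j\mu^k_je_j^*$. Player (II) wins if $(x_k)$ and $(e_k)$ are impartially $(C_r+\eta)$-equivalent, $(x_k^*)$ and $(e_k^*)$ are impartially $(C_r+\eta)$-equivalent, $\operatorname{dist}(x_k,W_k)<\eta_k$ and $\operatorname{dist}(x_k^*,G_k)<\eta_k$ for all $k$, and $\langle x_k^*,x_l\rangle=\delta_{kl}$ for all $k,l$. **Theorem.** Suppose that $(e_j)$ is $C_r$-strategically reproducible in $E$ with projectional factors and that $E$ has the $C$-primary diagonal factorization property with respect to $(e_j)$. Let $Z$ be one of the following spaces: (i) $Z=E$; (ii) $Z=\ell^p(E)$ for some $1\le p<\infty$; (iii) $Z=\ell^\infty(E)$, if $E$ is asymptotically curved with respect to $(e_j)$. Then $Z$ has the $\lambda C_rC$-primary factorization property, and $\mathcal M_Z$ is the unique maximal (two-sided) ideal of $\mathcal B(Z)$. Moreover, in cases (ii) and (iii), $Z$ is primary. -/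

import Mathlib

open scoped ENNReal

namespace StratRep

noncomputable section

/-! ### Factorization of operators -/

section Factorization

variable {E : Type*} [NormedAddCommGroup E] [NormedSpace ℝ E]

/-- `S` factors through `T` with constant `C` (and error `0`):
`S = A T B` for bounded linear operators `A`, `B` on `E` with `‖A‖ ‖B‖ ≤ C`. -/
def FactorsThrough (S T : E →L[ℝ] E) (C : ℝ) : Prop :=
  ∃ A B : E →L[ℝ] E, ‖A‖ * ‖B‖ ≤ C ∧ S = A ∘L T ∘L B

/-- `S` factors through `T` with constant `C⁺`, i.e. with constant `C + γ` for every `γ > 0`. -/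
def FactorsThroughPlus (S T : E →L[ℝ] E) (C : ℝ) : Prop :=
  ∀ γ : ℝ, 0 < γ → FactorsThrough S T (C + γ)

variable (E) in
/-- The `C`-primary factorization property: for every bounded linear operator `T` on `E`, the
identity of `E` factors through `T` or through `I - T` with constant `C⁺`. -/
def HasPrimaryFactorization (C : ℝ) : Prop :=
  ∀ T : E →L[ℝ] E,
    FactorsThroughPlus (ContinuousLinearMap.id ℝ E) T C ∨
      FactorsThroughPlus (ContinuousLinearMap.id ℝ E) (ContinuousLinearMap.id ℝ E - T) C

/-- A bounded linear operator `T` is diagonal with respect to a Schauder basis `(e_j)` with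
biorthogonal functionals `(e_j^*)` if `⟨e_k^*, T e_j⟩ = 0` whenever `k ≠ j`. -/
def IsDiagonal (b : SchauderBasis ℝ E) (T : E →L[ℝ] E) : Prop :=
  ∀ k j : ℕ, k ≠ j → b.coord k (T (b j)) = 0

/-- The `C`-primary diagonal factorization property with respect to a Schauder basis. -/
def HasPrimaryDiagonalFactorization (b : SchauderBasis ℝ E) (C : ℝ) : Prop :=
  ∀ T : E →L[ℝ] E, IsDiagonal b T →
    FactorsThroughPlus (ContinuousLinearMap.id ℝ E) T C ∨
      FactorsThroughPlus (ContinuousLinearMap.id ℝ E) (ContinuousLinearMap.id ℝ E - T) C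

variable (E) in
/-- The set `M_E` of all bounded linear operators on `E` through which the identity of `E` does
not factor. -/
def nonFactorSet : Set (E →L[ℝ] E) :=
  {T | ∀ A B : E →L[ℝ] E, ContinuousLinearMap.id ℝ E ≠ A ∘L T ∘L B}

variable (E) in
/-- `M_E` is a two-sided ideal of the algebra of bounded linear operators on `E`, it is a maximal
ideal, and it is the only one. -/
def NonFactorSetIsUniqueMaximalIdeal : Prop :=
  ∃ I : TwoSidedIdeal (E →L[ℝ] E), (I : Set (E →L[ℝ] E)) = nonFactorSet E ∧
    ∀ J : TwoSidedIdeal (E →L[ℝ] E), IsCoatom J ↔ J = I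

variable (E) in
/-- `E` is primary: whenever `E` is the direct sum of two closed subspaces `F` and `G`, at least
one of them is isomorphic to `E`. -/
def IsPrimarySpace : Prop :=
  ∀ F G : Submodule ℝ E, IsClosed (F : Set E) → IsClosed (G : Set E) → IsCompl F G →
    Nonempty (F ≃L[ℝ] E) ∨ Nonempty (G ≃L[ℝ] E)

end Factorization

/-! ### Asymptotically curved spaces -/

section Curved

variable {E : Type*} [NormedAddCommGroup E] [NormedSpace ℝ E]

/-- `(x_j)` is a block basis of `(e_j)`: nonzero vectors, each a finite linear combination of the
`e_i` with `i` in one of successive intervals. -/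
def IsBlockBasis (b : SchauderBasis ℝ E) (x : ℕ → E) : Prop :=
  ∃ p : ℕ → ℕ, StrictMono p ∧
    ∀ j, x j ≠ 0 ∧ x j ∈ Submodule.span ℝ (b '' Set.Ico (p j) (p (j + 1)))

/-- `E` is asymptotically curved with respect to `(e_j)`: the arithmetic means of every bounded
block basis of `(e_j)` tend to zero in norm. -/
def IsAsymptoticallyCurved (b : SchauderBasis ℝ E) : Prop :=
  ∀ x : ℕ → E, IsBlockBasis b x → (∃ M : ℝ, ∀ j, ‖x j‖ ≤ M) →
    Filter.Tendsto (fun n : ℕ => (1 / (n : ℝ)) * ‖∑ j ∈ Finset.range n, x j‖)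
      Filter.atTop (nhds 0)

end Curved

/-! ### Strategically reproducible bases -/

/-- Two sequences are impartially `C`-equivalent. -/
def ImpartiallyEquivalent {E F : Type*} [NormedAddCommGroup E] [NormedSpace ℝ E]
    [NormedAddCommGroup F] [NormedSpace ℝ F] (C : ℝ) (x : ℕ → E) (y : ℕ → F) : Prop :=
  ∀ a : ℕ →₀ ℝ,
    1 / √C * ‖a.sum fun j c => c • y j‖ ≤ ‖a.sum fun j c => c • x j‖ ∧
      ‖a.sum fun j c => c • x j‖ ≤ √C * ‖a.sum fun j c => c • y j‖

section Game

variable (E : Type*) [NormedAddCommGroup E] [NormedSpace ℝ E]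

/-- The move of player (I) in Step 1 of a turn: a number `η_k > 0`, a closed subspace `W_k` of
`E` of finite codimension, and a weak* closed subspace `G_k` of the dual of `E` of finite
codimension. -/
structure Challenge where
  tol : ℝ
  tol_pos : 0 < tol
  W : Submodule ℝ E
  W_closed : IsClosed (W : Set E)
  W_cofinite : FiniteDimensional ℝ (E ⧸ W)
  G : Submodule ℝ (StrongDual ℝ E)
  G_closed : IsClosed (StrongDual.toWeakDual '' (G : Set (StrongDual ℝ E)))
  G_cofinite : FiniteDimensional ℝ (StrongDual ℝ E ⧸ G)

/-- The move of player (II) in Step 2 of a turn: an index `i_k` of a cell of the partition, a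
finite set `E_k`, and the coefficients `λ_j^k`, `μ_j^k` (only their values for `j ∈ E_k` matter).
The rules that such a move has to obey are in `Response.IsLegal`. -/
structure Response where
  cell : Fin 2
  supp : Finset ℕ
  lam : ℕ → ℝ
  mu : ℕ → ℝ

/-- A move of player (I) in Step 3 of a turn: signs `ε_j^k` (only those with `j ∈ E_k` matter). -/
abbrev Signs : Type := ℕ → ℤˣ

/-- A strategy of player (II): the response in turn `k` is a function of the moves of player (I)
up to that point, i.e. of the challenges of turns `0, …, k` and of the signs chosen in turns
`0, …, k - 1`. -/
abbrev Strategy : Type _ :=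
  (k : ℕ) → (Fin (k + 1) → Challenge E) → (Fin k → Signs) → Response

variable {E}

/-- The rules for the move of player (II) in the game with parameter `η`, after player (I) has
chosen the partition `ℕ = N 0 ∪ N 1`. -/
def Response.IsLegal (N : Fin 2 → Set ℕ) (η : ℝ) (r : Response) : Prop :=
  (r.supp : Set ℕ) ⊆ N r.cell ∧
    (∀ j ∈ r.supp, 0 ≤ r.lam j ∧ 0 ≤ r.mu j) ∧
    1 - η < ∑ j ∈ r.supp, r.lam j * r.mu j ∧
    ∑ j ∈ r.supp, r.lam j * r.mu j < 1 + η

/-- The response of player (II) in turn `k`, if he follows the strategy `σ` and player (I) plays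
the challenges `c 0, c 1, …` and the signs `ε 0, ε 1, …`. -/
def Strategy.response (σ : Strategy E) (c : ℕ → Challenge E) (ε : ℕ → Signs) (k : ℕ) : Response :=
  σ k (fun i => c i) (fun i => ε i)

/-- The vector `x_k = ∑_{j ∈ E_k} ε_j^k λ_j^k e_j`. -/
def Response.vec (b : SchauderBasis ℝ E) (r : Response) (ε : Signs) : E :=
  ∑ j ∈ r.supp, (((ε j : ℤ) : ℝ) * r.lam j) • b j

/-- The functional `x_k^* = ∑_{j ∈ E_k} ε_j^k μ_j^k e_j^*`. -/
def Response.functional (b : SchauderBasis ℝ E) (r : Response) (ε : Signs) : StrongDual ℝ E :=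
  ∑ j ∈ r.supp, (((ε j : ℤ) : ℝ) * r.mu j) • b.coord j

/-- The demands on the outcome of the game with parameters `C`, `η`, where `x_k`, `x_k^*` are the
resulting vectors and functionals and `c_k` are the challenges of player (I). -/
def IsWinningOutcome (b : SchauderBasis ℝ E) (C η : ℝ) (c : ℕ → Challenge E)
    (x : ℕ → E) (xs : ℕ → StrongDual ℝ E) : Prop :=
  ImpartiallyEquivalent (C + η) x (fun k => b k) ∧
    ImpartiallyEquivalent (C + η) xs (fun k => b.coord k) ∧
    (∀ k, Metric.infDist (x k) ((c k).W : Set E) < (c k).tol) ∧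
    (∀ k, Metric.infDist (xs k) ((c k).G : Set (StrongDual ℝ E)) < (c k).tol)

/-- The Schauder basis `(e_j)` is `C`-strategically reproducible with projectional factors: for
every `η > 0` and every partition `ℕ = N 0 ∪ N 1` chosen by player (I) before the first turn,
player (II) has a strategy which, against all moves of player (I), produces legal moves and an
outcome that satisfies the demands of the game, and such that in addition `(x_k^*)` is
biorthogonal to `(x_k)`. -/
def IsStrategicallyReproducibleProj (b : SchauderBasis ℝ E) (C : ℝ) : Prop :=
  ∀ η : ℝ, 0 < η → ∀ N : Fin 2 → Set ℕ, N 0 ∪ N 1 = Set.univ → Disjoint (N 0) (N 1) →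
    ∃ σ : Strategy E, ∀ (c : ℕ → Challenge E) (ε : ℕ → Signs),
      (∀ k, (σ.response c ε k).IsLegal N η) ∧
      IsWinningOutcome b C η c
        (fun k => (σ.response c ε k).vec b (ε k))
        (fun k => (σ.response c ε k).functional b (ε k)) ∧
      ∀ k l, (σ.response c ε k).functional b (ε k) ((σ.response c ε l).vec b (ε l)) =
        if k = l then 1 else 0

end Game

end

end StratRep

open StratRep

/-! A winning strategy turns an arbitrary operator `T` into an almost diagonal one. Player (I) plays
the joint kernel of the functionals `x_m^* T` and the annihilator of the vectors `T x_m` already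
produced, so that all entries `x_m^* T x_n` with `m ≠ n` are as small as desired. Equivalence of
`(x_k)` with the basis gives `A : e_k ↦ x_k` with `‖A‖ ≤ √(C_r + η)`. Equivalence of `(x_k^*)` with
the coordinates gives, by duality, `B` with `e_k^* B = x_k^*` and `‖B‖ ≤ λ √(C_r + η)`.
Biorthogonality says `B A = I`. So `B T A` is diagonal up to a small error, `I - B T A = B (I - T)
A`, and the diagonal property together with the inversion of a perturbed identity gives the constant
`λ C_r C` (`HasPrimaryFactorization.of_reduction`).

On `ℓ^p(E)` one game is played for each summand, all of them simultaneously, which makes the whole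
matrix of `T` almost diagonal (`exists_almost_diagonalizing_operators`). For finite `p` the
corrected operator is a direct sum of diagonal operators `d_i`, and an infinite pigeonhole selects
summands on which `I` factors through all `d_i` or through all `I - d_i`. For `p = ∞` the corrected
operator differs from such a sum by an operator that kills the finitely supported sequences. An
uncountable almost disjoint family yields an infinite set of summands on which this operator
vanishes (`exists_strictMono_forall_eq_zero`).

The factorization property makes `M_Z` closed under addition, hence the largest proper ideal.
Applied to a projection of `ℓ^p(E)`, it places a complemented copy of the space in the range or the
kernel, and Pełczyński's decomposition method concludes. -/

namespace StratRep

open Filter Topology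

/-! ### Factorization properties, the maximal ideal, and perturbation -/

section Abstract

variable {E : Type*} [NormedAddCommGroup E] [NormedSpace ℝ E]

theorem FactorsThrough.mono {S T : E →L[ℝ] E} {C C' : ℝ} (h : FactorsThrough S T C)
    (hC : C ≤ C') : FactorsThrough S T C' := by
  obtain ⟨A, B, h1, h2⟩ := h
  exact ⟨A, B, h1.trans hC, h2⟩

/-- It suffices to decide the alternative separately for each error `γ`. -/
theorem HasPrimaryFactorization.of_forall {K : ℝ}
    (h : ∀ (T : E →L[ℝ] E) (γ : ℝ), 0 < γ →
      FactorsThrough (ContinuousLinearMap.id ℝ E) T (K + γ) ∨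
        FactorsThrough (ContinuousLinearMap.id ℝ E) (ContinuousLinearMap.id ℝ E - T) (K + γ)) :
    HasPrimaryFactorization E K := by
  intro T
  by_contra! hcon
  obtain ⟨h1, h2⟩ := hcon
  simp only [FactorsThroughPlus, not_forall] at h1 h2
  obtain ⟨γ₁, hγ₁, h1⟩ := h1
  obtain ⟨γ₂, hγ₂, h2⟩ := h2
  -- The alternative that holds may vary with `γ`, but a smaller error is the stronger claim.
  rcases h T (min γ₁ γ₂) (lt_min hγ₁ hγ₂) with h | h
  · exact h1 (h.mono (by gcongr; exact min_le_left _ _))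
  · exact h2 (h.mono (by gcongr; exact min_le_right _ _))

theorem mem_nonFactorSet_of_comp {T : E →L[ℝ] E} (hT : T ∈ nonFactorSet E) (A B : E →L[ℝ] E) :
    A ∘L T ∘L B ∈ nonFactorSet E := by
  intro A' B' h
  exact hT (A' ∘L A) (B ∘L B') (by rw [h]; rfl)

/-- A primary factorization property makes `nonFactorSet E` the largest proper ideal. -/
theorem HasPrimaryFactorization.nonFactorSetIsUniqueMaximalIdeal [Nontrivial E] {K : ℝ}
    (h : HasPrimaryFactorization E K) : NonFactorSetIsUniqueMaximalIdeal E := by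
  have hzero : (0 : E →L[ℝ] E) ∈ nonFactorSet E := by
    intro A B hAB
    obtain ⟨x, hx⟩ := exists_ne (0 : E)
    apply hx
    have := congrArg (fun f : E →L[ℝ] E => f x) hAB
    simpa using this
  have hadd : ∀ {S T : E →L[ℝ] E}, S ∈ nonFactorSet E → T ∈ nonFactorSet E →
      S + T ∈ nonFactorSet E := by
    intro S T hS hT A B hAB
    -- `A S B` and `A T B` sum to `I`, so the identity factors through one of them, hence through
    -- `S` or `T`.
    have hsub : ContinuousLinearMap.id ℝ E - A ∘L S ∘L B = A ∘L T ∘L B := by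
      rw [hAB]; ext x; simp
    rcases h (A ∘L S ∘L B) with h | h
    · obtain ⟨A', B', -, h⟩ := h 1 one_pos
      exact mem_nonFactorSet_of_comp hS A B A' B' h
    · rw [hsub] at h
      obtain ⟨A', B', -, h⟩ := h 1 one_pos
      exact mem_nonFactorSet_of_comp hT A B A' B' h
  have hleft : ∀ {S T : E →L[ℝ] E}, T ∈ nonFactorSet E → S * T ∈ nonFactorSet E := by
    intro S T hT
    exact mem_nonFactorSet_of_comp hT S 1
  have hright : ∀ {S T : E →L[ℝ] E}, S ∈ nonFactorSet E → S * T ∈ nonFactorSet E := by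
    intro S T hS
    exact mem_nonFactorSet_of_comp hS 1 T
  have hneg : ∀ {S : E →L[ℝ] E}, S ∈ nonFactorSet E → -S ∈ nonFactorSet E := by
    intro S hS
    have := hleft (S := -1) hS
    simpa using this
  let I : TwoSidedIdeal (E →L[ℝ] E) := .mk' (nonFactorSet E) hzero hadd hneg hleft hright
  have hI : (I : Set (E →L[ℝ] E)) = nonFactorSet E := by
    ext T
    exact TwoSidedIdeal.mem_mk' _ _ _ _ _ _ _
  have hone : (1 : E →L[ℝ] E) ∉ I := by
    intro h1
    have : (1 : E →L[ℝ] E) ∈ nonFactorSet E := hI ▸ h1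
    exact this 1 1 rfl
  have hItop : I ≠ ⊤ := fun h => hone (h ▸ trivial)
  -- An ideal containing an operator through which `I` factors contains `1`.
  have hle : ∀ J : TwoSidedIdeal (E →L[ℝ] E), J ≠ ⊤ → J ≤ I := by
    intro J hJ T hT
    have : T ∈ nonFactorSet E := by
      intro A B hAB
      apply hJ
      have h1 : (1 : E →L[ℝ] E) ∈ J := by
        have : (1 : E →L[ℝ] E) = A * (T * B) := hAB
        rw [this]
        exact J.mul_mem_left _ _ (J.mul_mem_right _ _ hT)
      rw [eq_top_iff]
      intro x _
      have := J.mul_mem_left x 1 h1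
      rwa [mul_one] at this
    show T ∈ (I : Set (E →L[ℝ] E))
    rwa [hI]
  refine ⟨I, hI, fun J => ⟨fun hJ => ?_, ?_⟩⟩
  · rcases (hle J hJ.1).lt_or_eq with hlt | heq
    · exact absurd (hJ.2 I hlt) hItop
    · exact heq
  · rintro rfl
    exact ⟨hItop, fun K hK => by_contra fun hne => (hle K hne).not_gt hK⟩

variable [CompleteSpace E]

/-- A small perturbation of the identity is invertible, with control of the inverse. -/
theorem exists_left_inverse_of_norm_le (N : E →L[ℝ] E) {ε : ℝ} (hN : ‖N‖ ≤ ε) (hε : ε < 1) :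
    ∃ V : E →L[ℝ] E, ‖V‖ ≤ (1 - ε)⁻¹ ∧ V ∘L (ContinuousLinearMap.id ℝ E + N) =
      ContinuousLinearMap.id ℝ E := by
  let u : (E →L[ℝ] E)ˣ := Units.oneSub (-N) (by rw [norm_neg]; exact hN.trans_lt hε)
  have hu : (u : E →L[ℝ] E) = ContinuousLinearMap.id ℝ E + N := by
    simp only [u, Units.val_oneSub, sub_neg_eq_add]; rfl
  refine ⟨(u⁻¹ : (E →L[ℝ] E)ˣ), ?_, by rw [← hu]; exact u.inv_mul⟩
  refine ContinuousLinearMap.opNorm_le_bound _ (by rw [inv_nonneg]; linarith) fun x => ?_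
  set y := (u⁻¹ : (E →L[ℝ] E)ˣ).val x with hy
  have hxy : x = y + N y := by
    have h1 : (u : E →L[ℝ] E) y = x := congrArg (fun f : E →L[ℝ] E => f x) u.mul_inv
    rw [hu] at h1
    simpa using h1.symm
  have h1 : ‖N y‖ ≤ ε * ‖y‖ := (N.le_opNorm y).trans (by gcongr)
  have h2 : ‖y‖ ≤ ‖x‖ + ‖N y‖ := by
    have : y = x - N y := eq_sub_of_add_eq hxy.symm
    rw [this]
    exact (norm_sub_le _ _).trans (by rw [← this])
  rw [inv_mul_eq_div, le_div_iff₀ (by linarith)]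
  nlinarith

/-- If `R (B T A - X) S = I` with `X` small, then `I` factors through `T`. -/
theorem factorsThrough_of_perturbation {T A B X R S : E →L[ℝ] E} {K₁ K₂ ε : ℝ}
    (hAB : ‖A‖ * ‖B‖ ≤ K₁) (hX : ‖X‖ ≤ ε) (hRS : ‖R‖ * ‖S‖ ≤ K₂) (hε : ε * K₂ < 1)
    (h : R ∘L (B ∘L T ∘L A - X) ∘L S = ContinuousLinearMap.id ℝ E) :
    FactorsThrough (ContinuousLinearMap.id ℝ E) T (K₁ * K₂ * (1 - ε * K₂)⁻¹) := by
  have hN : ‖R ∘L X ∘L S‖ ≤ ε * K₂ := by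
    calc ‖R ∘L X ∘L S‖ ≤ ‖R‖ * (‖X‖ * ‖S‖) :=
          (ContinuousLinearMap.opNorm_comp_le _ _).trans
            (by gcongr; exact ContinuousLinearMap.opNorm_comp_le _ _)
      _ = ‖X‖ * (‖R‖ * ‖S‖) := by ring
      _ ≤ ε * K₂ := by
          have := (norm_nonneg X).trans hX
          gcongr
  -- By `h`, `R B T A S = I + R X S`, a perturbation of `I` of norm at most `ε * K₂ < 1`.
  obtain ⟨V, hV, hVN⟩ := exists_left_inverse_of_norm_le _ hN hε
  refine ⟨V ∘L R ∘L B, A ∘L S, ?_, ?_⟩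
  · have h2 : 0 ≤ K₂ := le_trans (by positivity) hRS
    have h1 : 0 ≤ K₁ := le_trans (by positivity) hAB
    calc ‖V ∘L R ∘L B‖ * ‖A ∘L S‖ ≤ (‖V‖ * (‖R‖ * ‖B‖)) * (‖A‖ * ‖S‖) := by
          gcongr
          · exact (ContinuousLinearMap.opNorm_comp_le _ _).trans
              (by gcongr; exact ContinuousLinearMap.opNorm_comp_le _ _)
          · exact ContinuousLinearMap.opNorm_comp_le _ _
      _ = (‖A‖ * ‖B‖) * (‖R‖ * ‖S‖) * ‖V‖ := by ring
      _ ≤ _ := by gcongr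
  · rw [← hVN, ← h]
    ext x
    simp

/-- A uniform way to obtain a primary factorization property: every operator is reduced, up to
a small perturbation, to one which satisfies the alternative. -/
theorem HasPrimaryFactorization.of_reduction {L C : ℝ} {Cr : ℝ}
    (h : ∀ (T : E →L[ℝ] E) (t : ℝ), 0 < t → ∃ A B X R S : E →L[ℝ] E,
      B ∘L A = ContinuousLinearMap.id ℝ E ∧ ‖A‖ * ‖B‖ ≤ L * (Cr + t) ∧ ‖X‖ ≤ t ∧
      ‖R‖ * ‖S‖ ≤ C + t ∧
      (R ∘L (B ∘L T ∘L A - X) ∘L S = ContinuousLinearMap.id ℝ E ∨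
        R ∘L (ContinuousLinearMap.id ℝ E - (B ∘L T ∘L A - X)) ∘L S =
          ContinuousLinearMap.id ℝ E)) :
    HasPrimaryFactorization E (L * Cr * C) := by
  refine HasPrimaryFactorization.of_forall fun T γ hγ => ?_
  -- The constant of `factorsThrough_of_perturbation` tends to `L * Cr * C` as `t → 0`, so a small
  -- `t` costs less than `γ`.
  have hc : ContinuousAt (fun t : ℝ => L * (Cr + t) * (C + t) * (1 - t * (C + t))⁻¹) 0 :=
    ContinuousAt.mul (by fun_prop) (ContinuousAt.inv₀ (by fun_prop) (by simp))
  have hc2 : ContinuousAt (fun t : ℝ => t * (C + t)) 0 := by fun_prop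
  have e1 := hc.tendsto.eventually_lt_const (u := L * Cr * C + γ) (by simpa using hγ)
  have e2 := hc2.tendsto.eventually_lt_const (u := 1) (by simp)
  have e3 : ∀ᶠ t : ℝ in 𝓝[>] 0, 0 < t := self_mem_nhdsWithin
  obtain ⟨t, ⟨ht1, ht2⟩, ht⟩ :=
    (((e1.and e2).filter_mono nhdsWithin_le_nhds).and e3).exists
  obtain ⟨A, B, X, R, S, hBA, hAB, hX, hRS, h | h⟩ := h T t ht
  · exact .inl ((factorsThrough_of_perturbation hAB hX hRS ht2 h).mono ht1.le)
  -- Since `B A = I`, `I - (B T A - X) = B (I - T) A - (-X)`: the same data serve `I - T`.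
  · refine .inr ((factorsThrough_of_perturbation (X := -X) hAB (by rwa [norm_neg]) hRS ht2
      ?_).mono ht1.le)
    refine Eq.trans ?_ h
    congr 2
    ext z
    have hz : B (A z) = z := congrArg (fun f : E →L[ℝ] E => f z) hBA
    simp only [ContinuousLinearMap.comp_apply, _root_.sub_apply, _root_.neg_apply,
      ContinuousLinearMap.id_apply, map_sub, hz]
    abel

/-- Removing small off-diagonal entries with respect to a biorthogonal system. -/
theorem exists_small_offDiagonal (u : ℕ → E) (φ : ℕ → StrongDual ℝ E)
    (hφ : ∀ n m, φ n (u m) = if n = m then 1 else 0) {M δ : ℝ}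
    (hM : ∀ n m, ‖u n‖ * ‖φ m‖ ≤ M) (hδ : 0 ≤ δ) (D : E →L[ℝ] E)
    (hD : ∀ n m, n ≠ m → |φ n (D (u m))| ≤ δ * ((1 / 2) ^ n * (1 / 2) ^ m)) :
    ∃ X : E →L[ℝ] E, ‖X‖ ≤ 4 * M * δ ∧ ∀ n m, n ≠ m → φ n ((D - X) (u m)) = 0 := by
  have hM0 : 0 ≤ M := le_trans (by positivity) (hM 0 0)
  let a : ℕ × ℕ → ℝ := fun q => if q.1 = q.2 then 0 else φ q.1 (D (u q.2))
  have ha : ∀ q, |a q| ≤ δ * ((1 / 2) ^ q.1 * (1 / 2) ^ q.2) := by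
    intro q
    by_cases h : q.1 = q.2
    · simp only [a, h, if_true, abs_zero]; positivity
    · simpa only [a, h, if_false] using hD _ _ h
  -- Rank-one operators, each carrying a single off-diagonal entry of `D`. A double geometric series
  -- of sum `4` dominates their norms, and by biorthogonality their sum has exactly these entries.
  let F : ℕ × ℕ → E →L[ℝ] E := fun q => a q • (φ q.2).smulRight (u q.1)
  have hF : ∀ q, ‖F q‖ ≤ (M * δ) * ((1 / 2) ^ q.1 * (1 / 2) ^ q.2) := by
    intro q
    calc ‖F q‖ = |a q| * (‖u q.1‖ * ‖φ q.2‖) := by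
          simp only [F, norm_smul, ContinuousLinearMap.norm_smulRight_apply, Real.norm_eq_abs]
          ring
      _ ≤ (δ * ((1 / 2) ^ q.1 * (1 / 2) ^ q.2)) * M := by
          gcongr
          · exact ha q
          · exact hM _ _
      _ = _ := by ring
  have hg : HasSum (fun q : ℕ × ℕ => ((1 / 2 : ℝ) ^ q.1 * (1 / 2) ^ q.2)) (2 * 2) :=
    HasSum.mul hasSum_geometric_two hasSum_geometric_two
      (Summable.mul_of_nonneg summable_geometric_two summable_geometric_two
        (fun _ => by positivity) (fun _ => by positivity))
  have hg' := hg.mul_left (M * δ)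
  have hsum : Summable F := Summable.of_norm_bounded hg'.summable hF
  refine ⟨∑' q, F q, ?_, ?_⟩
  · refine (tsum_of_norm_bounded hg' hF).trans (le_of_eq (by ring))
  · intro n m hnm
    have h1 : HasSum (fun q => φ n (F q (u m))) (φ n ((∑' q, F q) (u m))) := by
      have := (hsum.hasSum.mapL ((ContinuousLinearMap.apply ℝ E (u m)))).mapL (φ n)
      simpa using this
    have h2 : HasSum (fun q => φ n (F q (u m))) (φ n (D (u m))) := by
      have : φ n (D (u m)) = φ n (F (n, m) (u m)) := by
        simp [F, a, hφ, hnm]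
      rw [this]
      refine hasSum_single _ fun q hq => ?_
      simp only [F, _root_.smul_apply, ContinuousLinearMap.smulRight_apply, map_smul, hφ,
        smul_eq_mul]
      by_cases h3 : n = q.1
      · by_cases h4 : q.2 = m
        · exact absurd (Prod.ext h3.symm h4) hq
        · simp [h4]
      · simp [h3]
    rw [_root_.sub_apply, map_sub, h1.unique h2, sub_self]

end Abstract

/-! ### Playing the games against a matrix of operators -/

section Game

variable {E : Type*} [NormedAddCommGroup E] [NormedSpace ℝ E]

theorem finiteDimensional_quotient_forall_eq_zero {V : Type*} [AddCommGroup V] [Module ℝ V]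
    {ι : Type*} [Finite ι] (W : Submodule ℝ V) (f : ι → V →ₗ[ℝ] ℝ)
    (hW : ∀ x, x ∈ W ↔ ∀ i, f i x = 0) : FiniteDimensional ℝ (V ⧸ W) := by
  have h : W = LinearMap.ker (LinearMap.pi f) := by
    ext x
    rw [hW, LinearMap.mem_ker, funext_iff]
    rfl
  rw [h]
  exact Module.Finite.equiv (LinearMap.quotKerEquivRange (LinearMap.pi f)).symm

/-- The challenge to come close to the joint kernel of finitely many functionals, and to the
functionals which vanish at finitely many vectors. -/
noncomputable def Challenge.ofFinite {ι κ : Type*} [Finite ι] [Finite κ]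
    (f : ι → StrongDual ℝ E) (v : κ → E)
    (tol : ℝ) (htol : 0 < tol) : Challenge E where
  tol := tol
  tol_pos := htol
  W := ⨅ i, LinearMap.ker (f i).toLinearMap
  W_closed := by
    simp only [Submodule.coe_iInf]
    exact isClosed_iInter fun i => (f i).isClosed_ker
  W_cofinite := finiteDimensional_quotient_forall_eq_zero _ (fun i => (f i).toLinearMap)
    (fun x => by simp)
  G := ⨅ i, LinearMap.ker (ContinuousLinearMap.apply ℝ ℝ (v i)).toLinearMap
  G_closed := by
    have h : StrongDual.toWeakDual '' ((⨅ i, LinearMap.ker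
        (ContinuousLinearMap.apply ℝ ℝ (v i)).toLinearMap : Submodule ℝ (StrongDual ℝ E)) :
          Set (StrongDual ℝ E)) = ⋂ i, {g : WeakDual ℝ E | g (v i) = 0} := by
      ext g
      simp only [Set.mem_image, SetLike.mem_coe, Submodule.mem_iInf, LinearMap.mem_ker,
        Set.mem_iInter, Set.mem_ofPred_eq]
      constructor
      · rintro ⟨x, hx, rfl⟩
        exact hx
      · intro hg
        exact ⟨WeakDual.toStrongDual g, hg, rfl⟩
    rw [h]
    exact isClosed_iInter fun i => isClosed_eq (WeakDual.eval_continuous _) continuous_const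
  G_cofinite := finiteDimensional_quotient_forall_eq_zero _
    (fun i => (ContinuousLinearMap.apply ℝ ℝ (v i)).toLinearMap) (fun x => by simp)

theorem Challenge.abs_apply_le_of_infDist_W {ι κ : Type*} [Finite ι] [Finite κ]
    (f : ι → StrongDual ℝ E) (v : κ → E) (tol : ℝ) (htol : 0 < tol) {x : E}
    (hx : Metric.infDist x ((Challenge.ofFinite f v tol htol).W : Set E) < tol) (i : ι) :
    |f i x| ≤ ‖f i‖ * tol := by
  obtain ⟨w, hw, hd⟩ := (Metric.infDist_lt_iff ⟨0, Submodule.zero_mem _⟩).1 hx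
  have hw0 : f i w = 0 := by
    have : w ∈ ⨅ i, LinearMap.ker (f i).toLinearMap := hw
    simp only [Submodule.mem_iInf, LinearMap.mem_ker] at this
    exact this i
  calc |f i x| = ‖f i (x - w)‖ := by rw [map_sub, hw0, sub_zero, Real.norm_eq_abs]
    _ ≤ ‖f i‖ * ‖x - w‖ := (f i).le_opNorm _
    _ ≤ _ := by rw [← dist_eq_norm]; gcongr

theorem Challenge.abs_apply_le_of_infDist_G {ι κ : Type*} [Finite ι] [Finite κ]
    (f : ι → StrongDual ℝ E) (v : κ → E) (tol : ℝ) (htol : 0 < tol) {g : StrongDual ℝ E}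
    (hg : Metric.infDist g ((Challenge.ofFinite f v tol htol).G : Set (StrongDual ℝ E)) < tol)
    (i : κ) : |g (v i)| ≤ ‖v i‖ * tol := by
  obtain ⟨w, hw, hd⟩ := (Metric.infDist_lt_iff ⟨0, Submodule.zero_mem _⟩).1 hg
  have hw0 : w (v i) = 0 := by
    have : w ∈ ⨅ i, LinearMap.ker (ContinuousLinearMap.apply ℝ ℝ (v i)).toLinearMap := hw
    simp only [Submodule.mem_iInf, LinearMap.mem_ker] at this
    exact this i
  calc |g (v i)| = ‖(g - w) (v i)‖ := by
        rw [_root_.sub_apply, hw0, sub_zero, Real.norm_eq_abs]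
    _ ≤ ‖g - w‖ * ‖v i‖ := (g - w).le_opNorm _
    _ ≤ _ := by rw [← dist_eq_norm, mul_comm]; gcongr

/-- A sequence defined by prescribing each term as a function of the previous ones. -/
theorem exists_seq_of_prefix {α : Type*} [Nonempty α] (F : ℕ → (ℕ → α) → α) :
    ∃ c : ℕ → α, ∀ n, ∃ c' : ℕ → α, (∀ m < n, c' m = c m) ∧ c n = F n c' := by
  classical
  obtain ⟨a⟩ := ‹Nonempty α›
  let c : ℕ → α := fun n => Nat.strongRec
    (fun n ih => F n (fun m => if h : m < n then ih m h else a)) n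
  -- The unknown terms from `n` on are filled with a default value, so `F n` can only use the past.
  refine ⟨c, fun n => ⟨fun m => if m < n then c m else a, fun m hm => by simp [hm], ?_⟩⟩
  simp only [c]
  rw [Nat.strongRec_eq]
  simp only [dite_eq_ite]

/-- Infinitely many games are played simultaneously, turn `j` of game `i` taking place at time
`Nat.pair i j`, in such a way that the outcomes almost diagonalize a given matrix of operators. -/
theorem exists_almost_diagonalizing_array (b : SchauderBasis ℝ E) {Cr : ℝ}
    (hrep : IsStrategicallyReproducibleProj b Cr) (T : ℕ → ℕ → E →L[ℝ] E) {η δ : ℝ} (hη : 0 < η)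
    (hδ : 0 < δ) :
    ∃ (x : ℕ → ℕ → E) (xs : ℕ → ℕ → StrongDual ℝ E),
      (∀ i, ImpartiallyEquivalent (Cr + η) (x i) (fun k => b k)) ∧
      (∀ i, ImpartiallyEquivalent (Cr + η) (xs i) (fun k => b.coord k)) ∧
      (∀ i k l, xs i k (x i l) = if k = l then 1 else 0) ∧
      (∀ i j, Summable fun k => ‖xs i k (b j)‖) ∧
      ∀ i j k l, (i, j) ≠ (k, l) → |xs i j (T i k (x k l))| ≤
        δ * ((1 / 2) ^ Nat.pair i j * (1 / 2) ^ Nat.pair k l) := by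
  -- The trivial partition suffices, and below all signs are `1`.
  obtain ⟨σ, hσ⟩ := hrep η hη ![Set.univ, ∅] (by simp) (by simp)
  let r : (ℕ → Challenge E) → ℕ → ℕ → Response := fun c i j =>
    σ.response (fun t => c (Nat.pair i t)) (fun _ _ => 1) j
  let X : (ℕ → Challenge E) → ℕ → E := fun c n =>
    (r c n.unpair.1 n.unpair.2).vec b (fun _ => 1)
  let Y : (ℕ → Challenge E) → ℕ → StrongDual ℝ E := fun c n =>
    (r c n.unpair.1 n.unpair.2).functional b (fun _ => 1)
  -- `Nat.pair` increases in its second argument, so the earlier turns of a game precede time `n`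
  -- and the response at time `n` depends only on the challenges up to that time.
  have hr : ∀ (c c' : ℕ → Challenge E) (n : ℕ), (∀ m ≤ n, c' m = c m) →
      r c' n.unpair.1 n.unpair.2 = r c n.unpair.1 n.unpair.2 := by
    intro c c' n h
    simp only [r, Strategy.response]
    congr 1
    funext t
    refine h _ ?_
    calc Nat.pair n.unpair.1 t ≤ Nat.pair n.unpair.1 n.unpair.2 := by
          rcases (Nat.lt_succ_iff.1 t.2).lt_or_eq with h | h
          · exact (Nat.pair_lt_pair_right _ h).le
          · rw [h]
      _ = n := Nat.pair_unpair n
  -- At time `n` the new vector is tested against the `f n c m` and the new functional against the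
  -- `v n c m`, for `m < n`; this covers both entries with indices `n`, `m`. The basis vectors are
  -- added as tests to make `xs i k (b j)` summable in `k`.
  let f : ℕ → (ℕ → Challenge E) → ℕ → StrongDual ℝ E := fun n c m =>
    (Y c m) ∘L (T m.unpair.1 n.unpair.1)
  let v : ℕ → (ℕ → Challenge E) → ℕ → E := fun n c m => T n.unpair.1 m.unpair.1 (X c m)
  let s : ℕ → (ℕ → Challenge E) → ℝ := fun n c =>
    1 + ∑ m ∈ Finset.range n, (‖f n c m‖ + ‖v n c m‖ + ‖b m‖)
  have hs1 : ∀ n c, 1 ≤ s n c := fun n c => by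
    simp only [s]
    linarith [Finset.sum_nonneg (s := Finset.range n)
      (f := fun m => ‖f n c m‖ + ‖v n c m‖ + ‖b m‖) (fun _ _ => by positivity)]
  have hs : ∀ n c, ∀ m < n, ‖f n c m‖ + ‖v n c m‖ + ‖b m‖ ≤ s n c := fun n c m hm => by
    have := Finset.single_le_sum (s := Finset.range n)
      (f := fun m => ‖f n c m‖ + ‖v n c m‖ + ‖b m‖) (fun _ _ => by positivity)
      (Finset.mem_range.2 hm)
    simp only [s]
    linarith
  -- Here `s` dominates the norms of all tests. An error `4⁻ⁿ` at the later time `n` of a pair is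
  -- enough, as `2⁻ⁿ ≤ 2⁻ᵐ` for `m ≤ n`.
  let τ : ℕ → (ℕ → Challenge E) → ℝ := fun n c => δ * ((1 / 2) ^ n * (1 / 2) ^ n) / s n c
  have hτ : ∀ n c, 0 < τ n c := fun n c => by
    have := hs1 n c
    simp only [τ]
    positivity
  let F : ℕ → (ℕ → Challenge E) → Challenge E := fun n c =>
    Challenge.ofFinite (fun m : Fin n => f n c m)
      (Sum.elim (fun m : Fin n => v n c m) (fun m : Fin n => b m)) (τ n c) (hτ n c)
  have : Nonempty (Challenge E) :=
    ⟨Challenge.ofFinite (fun i : Empty => i.elim) (fun i : Empty => i.elim) 1 one_pos⟩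
  obtain ⟨c, hc⟩ := exists_seq_of_prefix F
  have hXY : ∀ n c', (∀ m < n, c' m = c m) → ∀ m < n, X c' m = X c m ∧ Y c' m = Y c m := by
    intro n c' h m hm
    have := hr c c' m (fun l hl => h l (hl.trans_lt hm))
    simp only [X, Y, this, and_self]
  have hbound : ∀ n c' (a : ℝ), ∀ m < n, a ≤ ‖f n c' m‖ + ‖v n c' m‖ + ‖b m‖ →
      a * τ n c' ≤ δ * ((1 / 2) ^ n * (1 / 2) ^ n) := by
    intro n c' a m hm ha
    have h1 := hs1 n c'
    have h2 := ha.trans (hs n c' m hm)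
    simp only [τ]
    rw [← mul_div_assoc, div_le_iff₀ (by linarith), mul_comm]
    gcongr
  have key : ∀ n, ∀ m < n,
      |Y c m (T m.unpair.1 n.unpair.1 (X c n))| ≤ δ * ((1 / 2) ^ n * (1 / 2) ^ n) ∧
      |Y c n (T n.unpair.1 m.unpair.1 (X c m))| ≤ δ * ((1 / 2) ^ n * (1 / 2) ^ n) ∧
      |Y c n (b m)| ≤ δ * ((1 / 2) ^ n * (1 / 2) ^ n) := by
    intro n m hm
    obtain ⟨c', hc', hcn⟩ := hc n
    obtain ⟨-, ⟨-, -, hW, hG⟩, -⟩ :=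
      hσ (fun t => c (Nat.pair n.unpair.1 t)) (fun _ _ => 1)
    have hW := hW n.unpair.2
    have hG := hG n.unpair.2
    simp only [Nat.pair_unpair] at hW hG
    rw [hcn] at hW hG
    change Metric.infDist (X c n) _ < τ n c' at hW
    change Metric.infDist (Y c n) _ < τ n c' at hG
    obtain ⟨hX, hY⟩ := hXY n c' hc' m hm
    have e1 := Challenge.abs_apply_le_of_infDist_W _ _ _ _ hW ⟨m, hm⟩
    have e2 := Challenge.abs_apply_le_of_infDist_G _ _ _ _ hG (.inl ⟨m, hm⟩)
    have e3 := Challenge.abs_apply_le_of_infDist_G _ _ _ _ hG (.inr ⟨m, hm⟩)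
    have p1 := norm_nonneg (f n c' m)
    have p2 := norm_nonneg (v n c' m)
    have p3 := norm_nonneg (b m)
    refine ⟨?_, ?_, ?_⟩
    · refine le_trans (le_of_eq ?_) (e1.trans (hbound n c' _ m hm (by simp only; linarith)))
      simp only [f, hY, ContinuousLinearMap.comp_apply]
    · refine le_trans (le_of_eq ?_)
        (e2.trans (hbound n c' _ m hm (by simp only [Sum.elim_inl]; linarith)))
      simp only [v, hX, Sum.elim_inl]
    · exact e3.trans (hbound n c' _ m hm (by simp only [Sum.elim_inr]; linarith))
  have hpow : ∀ {n m : ℕ}, m ≤ n → δ * ((1 / 2 : ℝ) ^ n * (1 / 2) ^ n) ≤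
      δ * ((1 / 2) ^ n * (1 / 2) ^ m) := by
    intro n m h
    gcongr ?_ * (?_ * ?_)
    exact pow_le_pow_of_le_one (by norm_num) (by norm_num) h
  refine ⟨fun i j => X c (Nat.pair i j), fun i j => Y c (Nat.pair i j), ?_, ?_, ?_, ?_, ?_⟩
  · intro i
    simp only [X, Nat.unpair_pair]
    exact (hσ (fun t => c (Nat.pair i t)) (fun _ _ => 1)).2.1.1
  · intro i
    simp only [Y, Nat.unpair_pair]
    exact (hσ (fun t => c (Nat.pair i t)) (fun _ _ => 1)).2.1.2.1
  · intro i
    simp only [X, Y, Nat.unpair_pair]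
    exact (hσ (fun t => c (Nat.pair i t)) (fun _ _ => 1)).2.2
  · intro i j
    -- For `k > j` the time `Nat.pair i k ≥ k` is later than `j`, so `b j` is among the tests.
    rw [← summable_nat_add_iff (j + 1)]
    refine Summable.of_nonneg_of_le (fun _ => norm_nonneg _) (fun k => ?_)
      (summable_geometric_two.mul_left δ)
    have hk : k + (j + 1) ≤ Nat.pair i (k + (j + 1)) := Nat.right_le_pair _ _
    refine ((key _ j (by omega)).2.2).trans ?_
    have h1 : ((1 : ℝ) / 2) ^ Nat.pair i (k + (j + 1)) ≤ (1 / 2) ^ k :=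
      pow_le_pow_of_le_one (by norm_num) (by norm_num) (by omega)
    have h2 : ((1 : ℝ) / 2) ^ Nat.pair i (k + (j + 1)) ≤ 1 :=
      pow_le_one₀ (by norm_num) (by norm_num)
    gcongr
    calc _ ≤ ((1 : ℝ) / 2) ^ k * 1 := by gcongr
      _ = _ := mul_one _
  · intro i j k l hne
    have hne' : Nat.pair i j ≠ Nat.pair k l := fun h => hne (by
      have := Nat.pair_eq_pair.1 h
      rw [this.1, this.2])
    rcases hne'.lt_or_gt with h | h
    · have := (key _ _ h).1.trans (hpow h.le)
      rw [mul_comm ((1 / 2 : ℝ) ^ Nat.pair k l)] at this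
      simpa only [Nat.unpair_pair] using this
    · have := (key _ _ h).2.1.trans (hpow h.le)
      simpa only [Nat.unpair_pair] using this

end Game

/-! ### From equivalent sequences to operators, and the case of `E` -/

section Basis

variable {E : Type*} [NormedAddCommGroup E] [NormedSpace ℝ E]

theorem coord_basis (b : SchauderBasis ℝ E) (i j : ℕ) :
    b.coord i (b j) = if i = j then 1 else 0 := by
  classical
  rw [b.ortho]
  by_cases h : i = j <;> simp [h]

theorem ext_basis {F : Type*} [NormedAddCommGroup F] [NormedSpace ℝ F] (b : SchauderBasis ℝ E)
    {S T : E →L[ℝ] F} (h : ∀ j, S (b j) = T (b j)) : S = T := by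
  ext z
  have h1 := (S.continuous.tendsto z).comp (b.tendsto_proj z)
  have h2 := (T.continuous.tendsto z).comp (b.tendsto_proj z)
  refine tendsto_nhds_unique h1 (h2.congr fun n => ?_)
  simp [h]

theorem eq_zero_of_coord (b : SchauderBasis ℝ E) {z : E} (h : ∀ k, b.coord k z = 0) : z = 0 := by
  refine tendsto_nhds_unique (b.tendsto_proj z) ?_
  simp [h]

/-- A bounded sequence of operators which converges at all vectors of a basis converges
pointwise. -/
theorem exists_tendsto_of_basis {F : Type*} [NormedAddCommGroup F] [NormedSpace ℝ F]
    [CompleteSpace F] [CompleteSpace E] (b : SchauderBasis ℝ E) (L : ℕ → E →L[ℝ] F) {M : ℝ}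
    (hM : ∀ n z, ‖L n z‖ ≤ M * ‖z‖) (hb : ∀ j, ∃ y, Tendsto (fun n => L n (b j)) atTop (𝓝 y)) :
    ∃ S : E →L[ℝ] F, ∀ z, Tendsto (fun n => L n z) atTop (𝓝 (S z)) := by
  have h : ∀ z, ∃ y, Tendsto (fun n => L n z) atTop (𝓝 y) := by
    intro z
    refine cauchySeq_tendsto_of_complete (Metric.cauchySeq_iff'.2 fun ε hε => ?_)
    obtain ⟨m, hm⟩ : ∃ m, (|M| + 1) * ‖z - b.proj m z‖ < ε / 3 := by
      have h1 : Tendsto (fun m => (|M| + 1) * ‖z - b.proj m z‖) atTop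
          (𝓝 ((|M| + 1) * ‖z - z‖)) :=
        ((tendsto_const_nhds.sub (b.tendsto_proj z)).norm).const_mul _
      rw [sub_self, norm_zero, mul_zero] at h1
      exact (h1.eventually_lt_const (by positivity : (0 : ℝ) < ε / 3)).exists
    have hP : ∃ y, Tendsto (fun n => L n (b.proj m z)) atTop (𝓝 y) := by
      choose y hy using hb
      refine ⟨∑ i ∈ Finset.range m, b.coord i z • y i, ?_⟩
      simp only [SchauderBasis.proj_apply, map_sum, map_smul]
      exact tendsto_finsetSum _ fun i _ => (hy i).const_smul _
    obtain ⟨y, hy⟩ := hP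
    obtain ⟨N, hN⟩ := Metric.cauchySeq_iff'.1 hy.cauchySeq (ε / 3) (by positivity)
    refine ⟨N, fun n hn => ?_⟩
    have hd : ∀ k, ‖L k (z - b.proj m z)‖ < ε / 3 := fun k => by
      refine ((hM k _).trans ?_).trans_lt hm
      gcongr
      linarith [le_abs_self M]
    have h2 := hN n hn
    rw [dist_eq_norm] at h2 ⊢
    have : L n z - L N z = L n (z - b.proj m z) - L N (z - b.proj m z) +
        (L n (b.proj m z) - L N (b.proj m z)) := by
      simp only [map_sub]; abel
    rw [this]
    calc _ ≤ ‖L n (z - b.proj m z)‖ + ‖L N (z - b.proj m z)‖ + _ :=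
          (norm_add_le _ _).trans (by gcongr; exact norm_sub_le _ _)
      _ < ε / 3 + ε / 3 + ε / 3 := by
          gcongr
          · exact hd n
          · exact hd N
      _ = ε := by ring
  choose S hS using h
  exact ⟨continuousLinearMapOfTendsto L (tendsto_pi_nhds.2 hS), hS⟩

theorem ImpartiallyEquivalent.norm_sum_le {F : Type*} [NormedAddCommGroup F] [NormedSpace ℝ F]
    {K : ℝ} {x : ℕ → E} {y : ℕ → F} (h : ImpartiallyEquivalent K x y) (n : ℕ) (a : ℕ → ℝ) :
    ‖∑ j ∈ Finset.range n, a j • x j‖ ≤ √K * ‖∑ j ∈ Finset.range n, a j • y j‖ := by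
  have h1 := (h (Finsupp.onFinset (Finset.range n) (fun j => if j < n then a j else 0)
    (by intro j; simp; tauto))).2
  rw [Finsupp.onFinset_sum _ (by simp), Finsupp.onFinset_sum _ (by simp)] at h1
  rw [Finset.sum_congr rfl fun j hj => by rw [if_pos (Finset.mem_range.1 hj)],
    Finset.sum_congr (g := fun j => a j • y j) rfl
      fun j hj => by rw [if_pos (Finset.mem_range.1 hj)]] at h1
  exact h1

variable [CompleteSpace E]

/-- The `k`-th term of the expansion is the difference of two consecutive basis projections. -/
theorem norm_coord_le (b : SchauderBasis ℝ E) (hnorm : ∀ j, ‖b j‖ = 1) (k : ℕ) :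
    ‖b.coord k‖ ≤ 2 * b.nnnormProjBound := by
  refine ContinuousLinearMap.opNorm_le_bound _ (by positivity) fun z => ?_
  have h : b.coord k z • b k = b.proj (k + 1) z - b.proj k z := by
    simp [Finset.sum_range_succ]
  calc ‖b.coord k z‖ = ‖b.coord k z • b k‖ := by rw [norm_smul, hnorm, mul_one]
    _ ≤ ‖b.proj (k + 1) z‖ + ‖b.proj k z‖ := by rw [h]; exact norm_sub_le _ _
    _ ≤ ‖b.proj (k + 1)‖ * ‖z‖ + ‖b.proj k‖ * ‖z‖ := by
        gcongr <;> exact ContinuousLinearMap.le_opNorm _ _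
    _ ≤ b.nnnormProjBound * ‖z‖ + b.nnnormProjBound * ‖z‖ := by
        gcongr <;> exact b.norm_proj_le_nnnormProjBound _
    _ = _ := by ring

/-- The operator which maps the basis to an equivalent sequence. -/
theorem exists_operator_of_equivalent (b : SchauderBasis ℝ E) {K : ℝ} {x : ℕ → E}
    (hx : ImpartiallyEquivalent K x (fun k => b k)) :
    ∃ A : E →L[ℝ] E, ‖A‖ ≤ √K ∧ ∀ j, A (b j) = x j := by
  let L : ℕ → E →L[ℝ] E := fun n => ∑ j ∈ Finset.range n, (b.coord j).smulRight (x j)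
  have hL : ∀ n z, ‖L n z‖ ≤ √K * ‖b.proj n z‖ := fun n z => by
    have := hx.norm_sum_le n (fun j => b.coord j z)
    simpa [L, _root_.sum_apply] using this
  have hb : ∀ j, Tendsto (fun n => L n (b j)) atTop (𝓝 (x j)) := fun j => by
    refine tendsto_const_nhds.congr' ?_
    filter_upwards [eventually_gt_atTop j] with n hn
    simp [L, _root_.sum_apply, coord_basis, hn]
  obtain ⟨A, hA⟩ := exists_tendsto_of_basis b L (M := √K * b.nnnormProjBound) (fun n z => by
    refine (hL n z).trans ?_
    rw [mul_assoc]
    gcongr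
    exact (ContinuousLinearMap.le_opNorm _ _).trans
      (by gcongr; exact b.norm_proj_le_nnnormProjBound _)) (fun j => ⟨_, hb j⟩)
  refine ⟨A, ContinuousLinearMap.opNorm_le_bound _ (by positivity) fun z => ?_,
    fun j => tendsto_nhds_unique (hA _) (hb j)⟩
  -- The bound by `√K * ‖b.proj n z‖` passes to the limit without losing the basis constant.
  exact le_of_tendsto_of_tendsto (hA z).norm ((b.tendsto_proj z).norm.const_mul _)
    (Eventually.of_forall fun n => hL n z)

/-- The operator which has a sequence equivalent to the coordinate functionals as its
coordinates. -/
theorem exists_operator_of_coord_equivalent (b : SchauderBasis ℝ E) {K : ℝ}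
    (hnorm : ∀ j, ‖b j‖ = 1)
    {xs : ℕ → StrongDual ℝ E} (hxs : ImpartiallyEquivalent K xs (fun k => b.coord k))
    (hsum : ∀ j, Summable fun k => ‖xs k (b j)‖) :
    ∃ B : E →L[ℝ] E, ‖B‖ ≤ b.nnnormProjBound * √K ∧ ∀ k z, b.coord k (B z) = xs k z := by
  let L : ℕ → E →L[ℝ] E := fun n => ∑ k ∈ Finset.range n, (xs k).smulRight (b k)
  have hL : ∀ n z, ‖L n z‖ ≤ b.nnnormProjBound * √K * ‖z‖ := fun n z => by
    -- Testing against `f` turns the sum into a combination of the `xs k`, comparable with `f ∘L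
    -- b.proj n`. This is where the factor `λ` of the theorem enters.
    refine NormedSpace.norm_le_dual_bound ℝ _ (by positivity) fun f => ?_
    have h1 : f (L n z) = (∑ k ∈ Finset.range n, f (b k) • xs k) z := by
      simp [L, _root_.sum_apply, mul_comm]
    have h2 : ∑ k ∈ Finset.range n, f (b k) • b.coord k = f ∘L b.proj n := by
      ext w
      simp [_root_.sum_apply, mul_comm]
    have h3 := hxs.norm_sum_le n (fun k => f (b k))
    rw [h2] at h3
    rw [h1]
    calc _ ≤ ‖∑ k ∈ Finset.range n, f (b k) • xs k‖ * ‖z‖ := ContinuousLinearMap.le_opNorm _ _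
      _ ≤ (√K * (‖f‖ * b.nnnormProjBound)) * ‖z‖ := by
          gcongr
          refine h3.trans ?_
          gcongr
          exact (ContinuousLinearMap.opNorm_comp_le _ _).trans
            (by gcongr; exact b.norm_proj_le_nnnormProjBound _)
      _ = _ := by ring
  -- Equivalence only bounds the partial sums; their convergence at `b j` comes from `hsum`.
  obtain ⟨B, hB⟩ := exists_tendsto_of_basis b L hL (fun j => by
    have : Summable fun k => xs k (b j) • b k :=
      Summable.of_norm (by simpa [norm_smul, hnorm] using hsum j)
    refine ⟨_, this.hasSum.tendsto_sum_nat.congr fun n => ?_⟩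
    simp [L, _root_.sum_apply])
  refine ⟨B, ContinuousLinearMap.opNorm_le_bound _ (by positivity) fun z =>
    le_of_tendsto (hB z).norm (Eventually.of_forall fun n => hL n z), fun k z => ?_⟩
  refine tendsto_nhds_unique (((b.coord k).continuous.tendsto _).comp (hB z))
    (tendsto_const_nhds.congr' ?_)
  filter_upwards [eventually_gt_atTop k] with n hn
  simp [L, _root_.sum_apply, coord_basis, hn]

/-- Simultaneous almost diagonalization of a matrix of operators on a space with a strategically
reproducible basis. -/
theorem exists_almost_diagonalizing_operators (b : SchauderBasis ℝ E) (hnorm : ∀ j, ‖b j‖ = 1)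
    {Cr : ℝ} (hrep : IsStrategicallyReproducibleProj b Cr) (T : ℕ → ℕ → E →L[ℝ] E) {η δ : ℝ}
    (hη : 0 < η) (hδ : 0 < δ) :
    ∃ A B : ℕ → E →L[ℝ] E, (∀ i, ‖A i‖ ≤ √(Cr + η)) ∧
      (∀ i, ‖B i‖ ≤ b.nnnormProjBound * √(Cr + η)) ∧
      (∀ i, B i ∘L A i = ContinuousLinearMap.id ℝ E) ∧
      ∀ i j k l, (i, j) ≠ (k, l) → |b.coord j ((B i) (T i k (A k (b l))))| ≤
        δ * ((1 / 2) ^ Nat.pair i j * (1 / 2) ^ Nat.pair k l) := by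
  obtain ⟨x, xs, hx, hxs, hbi, hsum, hT⟩ := exists_almost_diagonalizing_array b hrep T hη hδ
  choose A hA hAb using fun i => exists_operator_of_equivalent b (hx i)
  choose B hB hBc using fun i => exists_operator_of_coord_equivalent b hnorm (hxs i) (hsum i)
  refine ⟨A, B, hA, hB, fun i => ext_basis b fun j => ?_, fun i j k l h => ?_⟩
  · rw [← sub_eq_zero]
    refine eq_zero_of_coord b fun k => ?_
    rw [map_sub, ContinuousLinearMap.comp_apply, hBc, hAb, hbi, ContinuousLinearMap.id_apply,
      coord_basis, sub_self]
  · rw [hBc, hAb]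
    exact hT i j k l h

/-- The primary factorization property of the space `E` itself. -/
theorem hasPrimaryFactorization_of_strategicallyReproducible (b : SchauderBasis ℝ E)
    (hnorm : ∀ j, ‖b j‖ = 1) {Cr C : ℝ} (hCr : 0 ≤ Cr)
    (hrep : IsStrategicallyReproducibleProj b Cr) (hdiag : HasPrimaryDiagonalFactorization b C) :
    HasPrimaryFactorization E (b.nnnormProjBound * Cr * C) := by
  refine HasPrimaryFactorization.of_reduction fun T t ht => ?_
  set Λ : ℝ := (SchauderBasis.nnnormProjBound b : ℝ)
  have hΛ : 0 ≤ Λ := NNReal.coe_nonneg _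
  -- Only game `0` matters here. Coordinates have norm at most `2 * Λ`, so the correction has norm
  -- at most `4 * (2 * Λ) * δ ≤ t`; the `+ 1` keeps the denominator positive.
  obtain ⟨A, B, hA, hB, hBA, hT⟩ := exists_almost_diagonalizing_operators b hnorm hrep
    (fun _ _ => T) ht (δ := t / (8 * Λ + 1)) (by positivity)
  obtain ⟨X, hX, hXd⟩ := exists_small_offDiagonal (fun j => b j) (fun j => b.coord j)
    (coord_basis b) (M := 2 * Λ) (δ := t / (8 * Λ + 1))
    (fun n m => by rw [hnorm, one_mul]; exact norm_coord_le b hnorm m) (by positivity)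
    (B 0 ∘L T ∘L A 0) (fun n m h => by
      refine (hT 0 n 0 m (by simpa using h)).trans ?_
      have hp : ∀ n : ℕ, ((1 : ℝ) / 2) ^ Nat.pair 0 n ≤ (1 / 2) ^ n := fun n =>
        pow_le_pow_of_le_one (by norm_num) (by norm_num) (Nat.right_le_pair _ _)
      gcongr ?_ * (?_ * ?_)
      · exact hp n
      · exact hp m)
  have hXt : ‖X‖ ≤ t := by
    refine hX.trans ?_
    rw [mul_div_assoc', div_le_iff₀ (by positivity)]
    nlinarith
  have hAB : ‖A 0‖ * ‖B 0‖ ≤ Λ * (Cr + t) := by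
    calc ‖A 0‖ * ‖B 0‖ ≤ √(Cr + t) * (Λ * √(Cr + t)) := by
          gcongr
          · exact hA 0
          · exact hB 0
      _ = Λ * (√(Cr + t) * √(Cr + t)) := by ring
      _ = _ := by rw [Real.mul_self_sqrt (by linarith)]
  rcases hdiag (B 0 ∘L T ∘L A 0 - X) (fun k j h => hXd k j h) with h | h
  · obtain ⟨R, S, hRS, h⟩ := h t ht
    exact ⟨A 0, B 0, X, R, S, hBA 0, hAB, hXt, hRS, .inl h.symm⟩
  · obtain ⟨R, S, hRS, h⟩ := h t ht
    exact ⟨A 0, B 0, X, R, S, hBA 0, hAB, hXt, hRS, .inr h.symm⟩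

end Basis

/-! ### Coordinatewise operators and subsequences in `ℓ^p` sums -/

section SequenceSpaces

variable {X Y : Type*} [NormedAddCommGroup X] [NormedAddCommGroup Y] {p : ℝ≥0∞}

theorem norm_extend_rpow {e : ℕ → ℕ} (he : e.Injective) (z : ℕ → X) {r : ℝ} (hr : 0 < r) :
    (fun j => ‖Function.extend e z 0 j‖ ^ r) = Function.extend e (fun i => ‖z i‖ ^ r) 0 := by
  funext j
  by_cases h : ∃ i, e i = j
  · obtain ⟨i, rfl⟩ := h
    simp [he.extend_apply]
  · rw [Function.extend_apply' _ _ _ h, Function.extend_apply' _ _ _ h]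
    simp [hr.ne']

theorem memℓp_map [NormedSpace ℝ X] [NormedSpace ℝ Y] (A : ℕ → X →L[ℝ] Y) {M : ℝ}
    (hA : ∀ i, ‖A i‖ ≤ M) (z : lp (fun _ : ℕ => X) p) : Memℓp (fun i => A i (z i)) p :=
  ((lp.memℓp z).norm.const_mul M).mono fun i =>
    ((A i).le_opNorm _).trans (by gcongr; exact hA i)

variable [hp : Fact (1 ≤ p)]

theorem exponent_ne_zero (p : ℝ≥0∞) [hp : Fact (1 ≤ p)] : p ≠ 0 :=
  (zero_lt_one.trans_le hp.out).ne'

theorem exponent_toReal_pos (h : p ≠ ∞) : 0 < p.toReal :=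
  ENNReal.toReal_pos (exponent_ne_zero p) h

theorem memℓp_pull {e : ℕ → ℕ} (he : e.Injective) (z : lp (fun _ : ℕ => X) p) :
    Memℓp (fun i => z (e i)) p := by
  rcases eq_or_ne p ∞ with rfl | h
  · exact memℓp_infty ⟨‖z‖, by
      rintro _ ⟨i, rfl⟩
      exact lp.norm_apply_le_norm (exponent_ne_zero _) z _⟩
  · exact memℓp_gen (((lp.memℓp z).summable (exponent_toReal_pos h)).comp_injective he)

theorem memℓp_push {e : ℕ → ℕ} (he : e.Injective) (z : lp (fun _ : ℕ => X) p) :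
    Memℓp (fun j => Function.extend e z 0 j) p := by
  rcases eq_or_ne p ∞ with rfl | h
  · refine memℓp_infty ⟨‖z‖, ?_⟩
    rintro _ ⟨j, rfl⟩
    by_cases h : ∃ i, e i = j
    · obtain ⟨i, rfl⟩ := h
      simp only [he.extend_apply]
      exact lp.norm_apply_le_norm (exponent_ne_zero _) z _
    · simp [Function.extend_apply' _ _ _ h]
  · have hp' := exponent_toReal_pos (p := p) h
    refine memℓp_gen ?_
    rw [norm_extend_rpow he _ hp', summable_extend_zero he]
    exact (lp.memℓp z).summable hp'

variable [NormedSpace ℝ X] [NormedSpace ℝ Y]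

/-- The operator between `ℓ^p` sums which acts in each coordinate by a given operator. -/
noncomputable def lpMap (A : ℕ → X →L[ℝ] Y) (M : ℝ) (hA : ∀ i, ‖A i‖ ≤ M) :
    lp (fun _ : ℕ => X) p →L[ℝ] lp (fun _ : ℕ => Y) p :=
  LinearMap.mkContinuous
    { toFun := fun z => ⟨fun i => A i (z i), memℓp_map A hA z⟩
      map_add' := fun z w => lp.ext (funext fun i => map_add (A i) (z i) (w i))
      map_smul' := fun c z => lp.ext (funext fun i => map_smul (A i) c (z i)) } M (fun z => by
        have hM : 0 ≤ M := (norm_nonneg _).trans (hA 0)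
        have : ‖M • z‖ = M * ‖z‖ := by rw [norm_smul, Real.norm_of_nonneg hM]
        rw [← this]
        refine lp.norm_mono (exponent_ne_zero p) fun i => ?_
        refine ((A i).le_opNorm _).trans ?_
        rw [lp.coeFn_smul, Pi.smul_apply, norm_smul, Real.norm_of_nonneg hM]
        gcongr
        exact hA i)

@[simp]
theorem lpMap_apply (A : ℕ → X →L[ℝ] Y) (M : ℝ) (hA : ∀ i, ‖A i‖ ≤ M)
    (z : lp (fun _ : ℕ => X) p) (i : ℕ) : lpMap A M hA z i = A i (z i) := rfl

theorem norm_lpMap_le (A : ℕ → X →L[ℝ] Y) (M : ℝ) (hA : ∀ i, ‖A i‖ ≤ M) :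
    ‖(lpMap A M hA : lp (fun _ : ℕ => X) p →L[ℝ] lp (fun _ : ℕ => Y) p)‖ ≤ M :=
  LinearMap.mkContinuous_norm_le _ ((norm_nonneg _).trans (hA 0)) _

theorem lpMap_single (A : ℕ → X →L[ℝ] Y) (M : ℝ) (hA : ∀ i, ‖A i‖ ≤ M) (i : ℕ) (x : X) :
    lpMap A M hA (lp.single p i x) = lp.single p i (A i x) := by
  refine lp.ext (funext fun j => ?_)
  rw [lpMap_apply]
  by_cases h : j = i
  · subst h
    rw [lp.single_apply_self, lp.single_apply_self]
  · rw [lp.single_apply_ne _ _ _ h, lp.single_apply_ne _ _ _ h, map_zero]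

/-- Restriction of a sequence to a subsequence. -/
noncomputable def lpPull (e : ℕ → ℕ) (he : e.Injective) :
    lp (fun _ : ℕ => X) p →L[ℝ] lp (fun _ : ℕ => X) p :=
  LinearMap.mkContinuous
    { toFun := fun z => ⟨fun i => z (e i), memℓp_pull he z⟩
      map_add' := fun z w => rfl
      map_smul' := fun c z => rfl } 1 (fun z => by
        rw [one_mul]
        rcases eq_or_ne p ∞ with rfl | h
        · exact lp.norm_le_of_forall_le (norm_nonneg _)
            fun i => lp.norm_apply_le_norm (exponent_ne_zero _) z _
        · have hp' := exponent_toReal_pos (p := p) h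
          refine lp.norm_le_of_tsum_le hp' (norm_nonneg _) ?_
          rw [lp.norm_rpow_eq_tsum hp']
          exact tsum_comp_le_tsum_of_inj
            ((lp.memℓp z).summable hp') (fun _ => by positivity) he)

@[simp]
theorem lpPull_apply (e : ℕ → ℕ) (he : e.Injective) (z : lp (fun _ : ℕ => X) p) (i : ℕ) :
    lpPull e he z i = z (e i) := rfl

theorem norm_lpPull_le (e : ℕ → ℕ) (he : e.Injective) :
    ‖(lpPull e he : lp (fun _ : ℕ => X) p →L[ℝ] lp (fun _ : ℕ => X) p)‖ ≤ 1 :=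
  LinearMap.mkContinuous_norm_le _ zero_le_one _

/-- The sequence supported in a subsequence with prescribed terms there. -/
noncomputable def lpPush (e : ℕ → ℕ) (he : e.Injective) :
    lp (fun _ : ℕ => X) p →L[ℝ] lp (fun _ : ℕ => X) p :=
  LinearMap.mkContinuous
    { toFun := fun z => ⟨fun j => Function.extend e z 0 j, memℓp_push he z⟩
      map_add' := fun z w => lp.ext (funext fun j => by
        change Function.extend e (⇑(z + w)) 0 j =
          Function.extend e (⇑z) 0 j + Function.extend e (⇑w) 0 j
        by_cases h : ∃ i, e i = j
        · obtain ⟨i, rfl⟩ := h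
          rw [he.extend_apply, he.extend_apply, he.extend_apply]
          rfl
        · rw [Function.extend_apply' _ _ _ h, Function.extend_apply' _ _ _ h,
            Function.extend_apply' _ _ _ h, Pi.zero_apply, add_zero])
      map_smul' := fun c z => lp.ext (funext fun j => by
        change Function.extend e (⇑(c • z)) 0 j = c • Function.extend e (⇑z) 0 j
        by_cases h : ∃ i, e i = j
        · obtain ⟨i, rfl⟩ := h
          simp [he.extend_apply]
        · simp [Function.extend_apply' _ _ _ h]) } 1 (fun z => by
        rw [one_mul]
        rcases eq_or_ne p ∞ with rfl | h
        · refine lp.norm_le_of_forall_le (norm_nonneg _) fun j => ?_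
          change ‖Function.extend e (⇑z) 0 j‖ ≤ _
          by_cases h : ∃ i, e i = j
          · obtain ⟨i, rfl⟩ := h
            rw [he.extend_apply]
            exact lp.norm_apply_le_norm (exponent_ne_zero _) z _
          · simp [Function.extend_apply' _ _ _ h]
        · have hp' := exponent_toReal_pos (p := p) h
          refine lp.norm_le_of_tsum_le hp' (norm_nonneg _) ?_
          rw [lp.norm_rpow_eq_tsum hp']
          change ∑' j, ‖Function.extend e (⇑z) 0 j‖ ^ p.toReal ≤ _
          rw [norm_extend_rpow he _ hp', tsum_extend_zero he])

theorem lpPush_apply (e : ℕ → ℕ) (he : e.Injective) (z : lp (fun _ : ℕ => X) p) (i : ℕ) :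
    lpPush e he z (e i) = z i := he.extend_apply _ _ _

theorem lpPush_apply_of_notMem (e : ℕ → ℕ) (he : e.Injective) (z : lp (fun _ : ℕ => X) p) {j : ℕ}
    (hj : j ∉ Set.range e) : lpPush e he z j = 0 := Function.extend_apply' _ _ _ hj

theorem norm_lpPush_le (e : ℕ → ℕ) (he : e.Injective) :
    ‖(lpPush e he : lp (fun _ : ℕ => X) p →L[ℝ] lp (fun _ : ℕ => X) p)‖ ≤ 1 :=
  LinearMap.mkContinuous_norm_le _ zero_le_one _

end SequenceSpaces

/-! ### An uncountable almost disjoint family -/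

section AlmostDisjoint

/-- The codes of the initial segments of a branch of the binary tree. -/
def branchCode (f : ℕ → Bool) : ℕ → ℕ
  | 0 => 1
  | n + 1 => 2 * branchCode f n + (f n).toNat

/-- The leading digit `1` gives the code of a word of length `n` exactly `n + 1` binary digits, so
codes determine lengths. -/
theorem branchCode_bounds (f : ℕ → Bool) (n : ℕ) :
    2 ^ n ≤ branchCode f n ∧ branchCode f n < 2 ^ (n + 1) := by
  induction n with
  | zero => simp [branchCode]
  | succ n ih =>
    have := Bool.toNat_le (f n)
    simp only [branchCode, pow_succ] at *
    omega

theorem branchCode_strictMono (f : ℕ → Bool) : StrictMono (branchCode f) :=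
  strictMono_nat_of_lt_succ fun n =>
    (branchCode_bounds f n).2.trans_le (branchCode_bounds f (n + 1)).1

theorem eq_of_branchCode_eq {f g : ℕ → Bool} {n m : ℕ} (h : branchCode f n = branchCode g m) :
    n = m ∧ ∀ i < n, f i = g i := by
  have hnm : n = m := by
    by_contra hne
    rcases Ne.lt_or_gt hne with hlt | hlt
    · have h1 : 2 ^ (n + 1) ≤ 2 ^ m := Nat.pow_le_pow_right (by norm_num) hlt
      have := (branchCode_bounds f n).2
      have := (branchCode_bounds g m).1
      omega
    · have h1 : 2 ^ (m + 1) ≤ 2 ^ n := Nat.pow_le_pow_right (by norm_num) hlt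
      have := (branchCode_bounds g m).2
      have := (branchCode_bounds f n).1
      omega
  subst hnm
  refine ⟨rfl, ?_⟩
  induction n with
  | zero => simp
  | succ n ih =>
    have h1 := Bool.toNat_le (f n)
    have h2 := Bool.toNat_le (g n)
    simp only [branchCode] at h
    have h3 : branchCode f n = branchCode g n := by omega
    have h4 : f n = g n := by
      cases hf : f n <;> cases hg : g n <;> simp_all
    intro i hi
    rcases (Nat.lt_succ_iff.1 hi).lt_or_eq with hi | rfl
    · exact ih h3 i hi
    · exact h4

/-- If the branches differ at `i`, their common initial segments have length at most `i`, hence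
codes below `2 ^ (i + 1)`. -/
theorem exists_branchCode_disjoint {f g : ℕ → Bool} (h : f ≠ g) :
    ∃ L, ∀ n, L ≤ n → n ∈ Set.range (branchCode f) → n ∉ Set.range (branchCode g) := by
  obtain ⟨i, hi⟩ := Function.ne_iff.1 h
  refine ⟨2 ^ (i + 1), ?_⟩
  rintro _ hL ⟨k, rfl⟩ ⟨l, hl⟩
  obtain ⟨-, h2⟩ := eq_of_branchCode_eq hl.symm
  refine hi (h2 i ?_)
  by_contra hk
  have := (branchCode_bounds f k).2
  have h1 : 2 ^ (k + 1) ≤ 2 ^ (i + 1) := Nat.pow_le_pow_right (by norm_num) (by omega)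
  omega

end AlmostDisjoint

/-! ### Operators that kill the finitely supported sequences -/

section Vanishing

variable {X : Type*} [NormedAddCommGroup X] [NormedSpace ℝ X]

/-- Countably many functionals on an `ℓ^∞` sum which vanish at all finitely supported sequences
vanish at all sequences which are supported in some fixed infinite set. -/
theorem exists_strictMono_forall_eq_zero (φ : ℕ → StrongDual ℝ (lp (fun _ : ℕ => X) ∞))
    (hφ : ∀ k i x, φ k (lp.single ∞ i x) = 0) :
    ∃ m : ℕ → ℕ, StrictMono m ∧
      ∀ z : lp (fun _ : ℕ => X) ∞, (∀ n ∉ Set.range m, z n = 0) → ∀ k, φ k z = 0 := by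
  by_contra! hcon
  have hex : ∀ f : ℕ → Bool, ∃ (w : lp (fun _ : ℕ => X) ∞) (q : ℕ × ℕ), ‖w‖ ≤ 1 ∧
      (∀ n ∉ Set.range (branchCode f), w n = 0) ∧ 1 / ((q.2 : ℝ) + 1) < φ q.1 w := by
    intro f
    obtain ⟨z, hz, k, hk⟩ := hcon _ (branchCode_strictMono f)
    let c : ℝ := (‖z‖ + 1)⁻¹ * SignType.sign (φ k z)
    have hc : 0 < φ k (c • z) := by
      rw [map_smul, smul_eq_mul, mul_assoc, sign_mul_self]
      have := abs_pos.2 hk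
      positivity
    obtain ⟨r, hr⟩ := exists_nat_one_div_lt hc
    refine ⟨c • z, (k, r), ?_, fun n hn => ?_, hr⟩
    · have h1 : ‖c‖ ≤ (‖z‖ + 1)⁻¹ := by
        rw [norm_mul, Real.norm_of_nonneg (by positivity)]
        refine mul_le_of_le_one_right (by positivity) ?_
        rcases lt_trichotomy (φ k z) 0 with h | h | h <;> simp [h, sign_neg, sign_pos]
      rw [norm_smul]
      calc ‖c‖ * ‖z‖ ≤ (‖z‖ + 1)⁻¹ * ‖z‖ := by gcongr
        _ ≤ 1 := by
          rw [inv_mul_eq_div, div_le_one (by positivity)]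
          linarith
    · rw [lp.coeFn_smul, Pi.smul_apply, hz n hn, smul_zero]
  choose w q hw1 hwsupp hwq using hex
  -- Uncountably many branches and countably many pairs: one functional and one lower bound serve
  -- infinitely many branches.
  obtain ⟨⟨k, r⟩, hfib⟩ : ∃ a, (q ⁻¹' {a}).Infinite := by
    by_contra! hfin
    have hc : (Set.univ : Set (ℕ → Bool)).Countable := by
      have : (Set.univ : Set (ℕ → Bool)) = ⋃ a, q ⁻¹' {a} := by
        ext f; simp
      rw [this]
      exact Set.countable_iUnion fun a => (hfin a).countable
    have := Set.countable_univ_iff.1 hc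
    obtain ⟨ι, hι⟩ := exists_injective_nat (ℕ → Bool)
    classical
    refine Function.cantor_injective (fun s : Set ℕ => ι fun n => decide (n ∈ s)) ?_
    refine hι.comp fun s s' h => Set.ext fun n => ?_
    simpa using congrFun h n
  obtain ⟨N, hN⟩ := exists_nat_gt (‖φ k‖ * (r + 1))
  obtain ⟨t, htsub, htN⟩ := hfib.exists_subset_card_eq N
  -- Beyond a common `L` the `N` chosen supports are disjoint. Cutting off the coordinates below `L`
  -- does not change `φ k`, so the sum has norm at most `1` while `φ k` is at least `N / (r + 1) >
  -- ‖φ k‖` there.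
  choose! Lfg hL using fun (f g : ℕ → Bool) (h : f ≠ g) => exists_branchCode_disjoint h
  let L := t.sup fun f => t.sup fun g => Lfg f g
  have hLle : ∀ f ∈ t, ∀ g ∈ t, Lfg f g ≤ L := fun f hf g hg =>
    (Finset.le_sup (f := fun g => Lfg f g) hg).trans
      (Finset.le_sup (f := fun f => t.sup fun g => Lfg f g) hf)
  let v : (ℕ → Bool) → lp (fun _ : ℕ => X) ∞ := fun f =>
    w f - ∑ i ∈ Finset.range L, lp.single ∞ i (w f i)
  have hvφ : ∀ f, φ k (v f) = φ k (w f) := fun f => by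
    simp only [v, map_sub, map_sum, hφ, Finset.sum_const_zero, sub_zero]
  have hvc : ∀ f n, v f n = if n < L then 0 else w f n := fun f n => by
    simp only [v, lp.coeFn_sub, Pi.sub_apply, lp.coeFn_sum, Finset.sum_apply, lp.single_apply]
    simp only [Finset.sum_pi_single, Finset.mem_range]
    split_ifs <;> simp
  have hnorm : ‖∑ f ∈ t, v f‖ ≤ 1 := by
    refine lp.norm_le_of_forall_le zero_le_one fun n => ?_
    rw [lp.coeFn_sum, Finset.sum_apply]
    simp only [hvc]
    by_cases hn : n < L
    · simp [hn]
    simp only [hn, if_false]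
    by_cases hex : ∃ f ∈ t, w f n ≠ 0
    · obtain ⟨f, hf, hfn⟩ := hex
      rw [Finset.sum_eq_single_of_mem f hf fun g hg hgf => ?_]
      · exact (lp.norm_apply_le_norm ENNReal.top_ne_zero (w f) n).trans (hw1 f)
      · refine hwsupp g n (hL f g hgf.symm n ((hLle f hf g hg).trans (not_lt.1 hn)) ?_)
        by_contra hnot
        exact hfn (hwsupp f n hnot)
    · push Not at hex
      rw [Finset.sum_eq_zero hex, norm_zero]
      exact zero_le_one
  have h1 : (N : ℝ) * (1 / ((r : ℝ) + 1)) ≤ φ k (∑ f ∈ t, v f) := by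
    rw [map_sum, ← htN, ← nsmul_eq_mul]
    refine Finset.card_nsmul_le_sum _ _ _ fun f hf => ?_
    have h2 := hwq f
    rw [show q f = (k, r) from htsub hf] at h2
    rw [hvφ]
    exact h2.le
  have h2 : φ k (∑ f ∈ t, v f) ≤ ‖φ k‖ := by
    refine (le_abs_self _).trans (((φ k).le_opNorm _).trans ?_)
    exact mul_le_of_le_one_right (norm_nonneg _) hnorm
  have h3 := h1.trans h2
  rw [mul_one_div, div_le_iff₀ (by positivity)] at h3
  linarith

/-- An operator on an `ℓ^p` sum which vanishes at all finitely supported sequences vanishes at all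
sequences which are supported in some infinite set. -/
theorem exists_strictMono_operator_eq_zero {p : ℝ≥0∞} [Fact (1 ≤ p)] (φ : ℕ → StrongDual ℝ X)
    (hφ : ∀ x, (∀ k, φ k x = 0) → x = 0)
    (S : lp (fun _ : ℕ => X) p →L[ℝ] lp (fun _ : ℕ => X) p)
    (hS : ∀ i x, S (lp.single p i x) = 0) :
    ∃ m : ℕ → ℕ, StrictMono m ∧
      ∀ z : lp (fun _ : ℕ => X) p, (∀ n ∉ Set.range m, z n = 0) → S z = 0 := by
  -- For `p = ∞`, countably many functionals separate points of the target, so the previous result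
  -- applies to their compositions with `S`. For finite `p`, the finitely supported sequences are
  -- dense and `S = 0`.
  rcases eq_or_ne p ∞ with rfl | hp
  · obtain ⟨m, hm, h⟩ := exists_strictMono_forall_eq_zero
      (fun n => φ n.unpair.2 ∘L lp.evalCLM ℝ (fun _ : ℕ => X) ∞ n.unpair.1 ∘L S)
      (fun k i x => by simp [hS])
    refine ⟨m, hm, fun z hz => lp.ext (funext fun i => hφ _ fun k => ?_)⟩
    have := h z hz (Nat.pair i k)
    simp only [Nat.unpair_pair] at this
    exact this
  · refine ⟨id, strictMono_id, fun z _ => ?_⟩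
    have : S = 0 := lp.ext_continuousLinearMap hp fun i => by
      ext x : 1
      simpa using hS i x
    rw [this]
    rfl

end Vanishing

/-! ### Factorization in `ℓ^p` sums -/

section Reduction

variable {E : Type*} [NormedAddCommGroup E] [NormedSpace ℝ E] {p : ℝ≥0∞} [hp : Fact (1 ≤ p)]

/-- Rescaling puts the whole constant on the left factor, so a family of factorizations has
uniformly bounded factors that can be assembled by `lpMap`. -/
theorem FactorsThrough.exists_norm_le [Nontrivial E] {T : E →L[ℝ] E} {K : ℝ}
    (h : FactorsThrough (ContinuousLinearMap.id ℝ E) T K) :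
    ∃ R S : E →L[ℝ] E, ‖R‖ ≤ K ∧ ‖S‖ ≤ 1 ∧ ∀ x, R (T (S x)) = x := by
  obtain ⟨R, S, hRS, h⟩ := h
  have hS : 0 < ‖S‖ := by
    rw [norm_pos_iff]
    rintro rfl
    obtain ⟨x, hx⟩ := exists_ne (0 : E)
    apply hx
    simpa using congrArg (fun f : E →L[ℝ] E => f x) h
  refine ⟨‖S‖ • R, ‖S‖⁻¹ • S, ?_, ?_, fun x => ?_⟩
  · rwa [norm_smul, norm_norm, mul_comm]
  · rw [norm_smul, norm_inv, norm_norm, inv_mul_cancel₀ hS.ne']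
  · have := congrArg (fun f : E →L[ℝ] E => f x) h
    simp only [ContinuousLinearMap.id_apply, ContinuousLinearMap.comp_apply] at this
    simp only [_root_.smul_apply, map_smul, smul_smul]
    rw [inv_mul_cancel₀ hS.ne', one_smul, ← this]

/-- If the identity factors through each member of a family of operators on `E`, then the identity
of the `ℓ^p` sum factors through any operator which acts as this family on a subsequence. -/
theorem exists_factorization_of_rows [Nontrivial E] {K : ℝ}
    (D : lp (fun _ : ℕ => E) p →L[ℝ] lp (fun _ : ℕ => E) p) {e : ℕ → ℕ} (he : e.Injective)
    (d : ℕ → E →L[ℝ] E) (hD : ∀ z i, D (lpPush e he z) (e i) = d i (z i))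
    (hd : ∀ i, FactorsThrough (ContinuousLinearMap.id ℝ E) (d i) K) :
    ∃ R S : lp (fun _ : ℕ => E) p →L[ℝ] lp (fun _ : ℕ => E) p, ‖R‖ * ‖S‖ ≤ K ∧
      R ∘L D ∘L S = ContinuousLinearMap.id ℝ _ := by
  choose R S hR hS h using fun i => (hd i).exists_norm_le
  have hK : 0 ≤ K := (norm_nonneg _).trans (hR 0)
  refine ⟨lpMap R K hR ∘L lpPull e he, lpPush e he ∘L lpMap S 1 hS, ?_, ?_⟩
  · calc _ ≤ (K * 1) * (1 * 1) := by
          gcongr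
          · refine (ContinuousLinearMap.opNorm_comp_le _ _).trans ?_
            gcongr
            · exact norm_lpMap_le _ _ _
            · exact norm_lpPull_le _ _
          · refine (ContinuousLinearMap.opNorm_comp_le _ _).trans ?_
            gcongr
            · exact norm_lpPush_le _ _
            · exact norm_lpMap_le _ _ _
      _ = K := by ring
  · refine ContinuousLinearMap.ext fun z => lp.ext (funext fun i => ?_)
    simp only [ContinuousLinearMap.comp_apply, lpMap_apply, lpPull_apply, hD, h,
      ContinuousLinearMap.id_apply]

/-- An operator on an `ℓ^p` sum which maps each unit vector to a multiple of itself acts on some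
subsequence as a sequence of diagonal operators. -/
theorem exists_strictMono_rows_diagonal (b : SchauderBasis ℝ E)
    (D : lp (fun _ : ℕ => E) p →L[ℝ] lp (fun _ : ℕ => E) p)
    (hD : ∀ i j k l, (i, j) ≠ (k, l) → b.coord j (D (lp.single p k (b l)) i) = 0) :
    ∃ (d : ℕ → E →L[ℝ] E) (m : ℕ → ℕ), (∀ i, IsDiagonal b (d i)) ∧ StrictMono m ∧
      ∀ z : lp (fun _ : ℕ => E) p, (∀ n ∉ Set.range m, z n = 0) → ∀ i, D z i = d i (z i) := by
  let ev := lp.evalCLM ℝ (fun _ : ℕ => E) p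
  let sg := lp.singleContinuousLinearMap ℝ (fun _ : ℕ => E) p
  let d : ℕ → E →L[ℝ] E := fun i => ev i ∘L D ∘L sg i
  have hd : ∀ i, ‖d i‖ ≤ ‖D‖ := fun i => by
    refine ContinuousLinearMap.opNorm_le_bound _ (norm_nonneg _) fun x => ?_
    refine (lp.norm_apply_le_norm (exponent_ne_zero p) (D (lp.single p i x)) i).trans
      ((D.le_opNorm _).trans ?_)
    rw [lp.norm_single (pos_iff_ne_zero.2 (exponent_ne_zero p))]
  let Δ : lp (fun _ : ℕ => E) p →L[ℝ] lp (fun _ : ℕ => E) p := lpMap d ‖D‖ hd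
  -- `Δ` is the direct sum of the diagonal blocks of `D`; both have the same matrix, so they agree
  -- on each summand.
  have hS : ∀ i x, (D - Δ) (lp.single p i x) = 0 := by
    intro i x
    have : (D - Δ) ∘L sg i = 0 := ext_basis b fun l => by
      refine lp.ext (funext fun k => ?_)
      change D (lp.single p i (b l)) k - Δ (lp.single p i (b l)) k = 0
      simp only [Δ, lpMap_single]
      by_cases h : k = i
      · subst h
        rw [lp.single_apply_self]
        exact sub_self _
      · rw [lp.single_apply_ne _ _ _ h, sub_zero]
        exact eq_zero_of_coord b fun j => hD k j i l (by simp [h])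
    exact congrArg (fun f : E →L[ℝ] lp (fun _ : ℕ => E) p => f x) this
  obtain ⟨m, hm, h⟩ := exists_strictMono_operator_eq_zero (fun k => b.coord k)
    (fun x hx => eq_zero_of_coord b hx) _ hS
  refine ⟨d, m, fun i k j hkj => hD i k i j (by simp [hkj]), hm, fun z hz i => ?_⟩
  have h1 := congrArg (fun w : lp (fun _ : ℕ => E) p => w i) (h z hz)
  exact sub_eq_zero.1 h1

/-- An infinite pigeonhole: the diagonal property may choose `T` in one summand and `I - T` in
another, and a subsequence makes the choice uniform. -/
theorem exists_strictMono_forall_or {m : ℕ → ℕ} (hm : StrictMono m) {P Q : ℕ → Prop}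
    (h : ∀ n, P n ∨ Q n) :
    ∃ e : ℕ → ℕ, StrictMono e ∧ Set.range e ⊆ Set.range m ∧
      ((∀ i, P (e i)) ∨ ∀ i, Q (e i)) := by
  by_cases hP : ∃ᶠ n in atTop, P (m n)
  · obtain ⟨q, hq, hPq⟩ := extraction_of_frequently_atTop hP
    exact ⟨m ∘ q, hm.comp hq, Set.range_comp_subset_range q m, .inl hPq⟩
  · have hQ : ∃ᶠ n in atTop, Q (m n) := by
      refine Eventually.frequently ?_
      filter_upwards [not_frequently.1 hP] with n hn using (h _).resolve_left hn
    obtain ⟨q, hq, hQq⟩ := extraction_of_frequently_atTop hQ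
    exact ⟨m ∘ q, hm.comp hq, Set.range_comp_subset_range q m, .inr hQq⟩

variable [CompleteSpace E]

/-- The primary factorization property of the `ℓ^p` sums of `E`, for `1 ≤ p ≤ ∞`. For `p = ∞` the
part of an operator which vanishes at the finitely supported sequences is removed by passing to a
subsequence of the summands, so that `E` need not be asymptotically curved. -/
theorem hasPrimaryFactorization_lp_of_strategicallyReproducible (b : SchauderBasis ℝ E)
    (hnorm : ∀ j, ‖b j‖ = 1) {Cr C : ℝ} (hCr : 0 ≤ Cr)
    (hrep : IsStrategicallyReproducibleProj b Cr) (hdiag : HasPrimaryDiagonalFactorization b C) :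
    HasPrimaryFactorization (lp (fun _ : ℕ => E) p) (b.nnnormProjBound * Cr * C) := by
  have : Nontrivial E := ⟨b 0, 0, by rw [← norm_ne_zero_iff, hnorm]; exact one_ne_zero⟩
  refine HasPrimaryFactorization.of_reduction fun T t ht => ?_
  set Λ : ℝ := (SchauderBasis.nnnormProjBound b : ℝ)
  have hΛ : 0 ≤ Λ := NNReal.coe_nonneg _
  let ev := lp.evalCLM ℝ (fun _ : ℕ => E) p
  let sg := lp.singleContinuousLinearMap ℝ (fun _ : ℕ => E) p
  -- Game `i` is played in summand `i`, against the block of `T` from summand `k` to summand `i` for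
  -- every `k`.
  obtain ⟨A, B, hA, hB, hBA, hT⟩ := exists_almost_diagonalizing_operators b hnorm hrep
    (fun i k => ev i ∘L T ∘L sg k) ht (δ := t / (8 * Λ + 1)) (by positivity)
  let A' : lp (fun _ : ℕ => E) p →L[ℝ] lp (fun _ : ℕ => E) p := lpMap A _ hA
  let B' : lp (fun _ : ℕ => E) p →L[ℝ] lp (fun _ : ℕ => E) p := lpMap B _ hB
  have hBA' : B' ∘L A' = ContinuousLinearMap.id ℝ _ := by
    refine ContinuousLinearMap.ext fun z => lp.ext (funext fun i => ?_)
    exact congrArg (fun f : E →L[ℝ] E => f (z i)) (hBA i)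
  -- The basis vectors of all summands form one biorthogonal system, enumerated by the pairing that
  -- also gives the weights in `hT`.
  let u : ℕ → lp (fun _ : ℕ => E) p := fun n => lp.single p n.unpair.1 (b n.unpair.2)
  let φ : ℕ → StrongDual ℝ (lp (fun _ : ℕ => E) p) := fun n =>
    b.coord n.unpair.2 ∘L ev n.unpair.1
  have hφapp : ∀ n z, φ n z = b.coord n.unpair.2 (z n.unpair.1) := fun n z => rfl
  have hu : ∀ n, ‖u n‖ = 1 := fun n => by
    simp only [u]
    rw [lp.norm_single (pos_iff_ne_zero.2 (exponent_ne_zero p)), hnorm]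
  have hφ : ∀ n, ‖φ n‖ ≤ 2 * Λ := fun n => by
    refine ContinuousLinearMap.opNorm_le_bound _ (by positivity) fun z => ?_
    rw [hφapp]
    refine ((b.coord _).le_opNorm _).trans ?_
    gcongr
    · exact norm_coord_le b hnorm _
    · exact lp.norm_apply_le_norm (exponent_ne_zero p) z _
  have hbi : ∀ n m, φ n (u m) = if n = m then 1 else 0 := fun n m => by
    rw [hφapp]
    by_cases h : n = m
    · subst h
      simp only [u, lp.single_apply_self, coord_basis, if_true]
    · rw [if_neg h]
      by_cases h1 : n.unpair.1 = m.unpair.1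
      · have h2 : n.unpair.2 ≠ m.unpair.2 := fun h2 => h (by
          rw [← Nat.pair_unpair n, ← Nat.pair_unpair m, h1, h2])
        simp only [u, h1, lp.single_apply_self, coord_basis, if_neg h2]
      · simp only [u]
        rw [lp.single_apply_ne _ _ _ h1, map_zero]
  obtain ⟨X, hX, hXd⟩ := exists_small_offDiagonal u φ hbi (M := 2 * Λ) (δ := t / (8 * Λ + 1))
    (fun n m => by rw [hu, one_mul]; exact hφ m) (by positivity)
    (B' ∘L T ∘L A') (fun n m h => by
      have h1 := hT n.unpair.1 n.unpair.2 m.unpair.1 m.unpair.2 (fun h1 => h (by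
        rw [Prod.mk.injEq] at h1
        rw [← Nat.pair_unpair n, ← Nat.pair_unpair m, h1.1, h1.2]))
      rw [Nat.pair_unpair, Nat.pair_unpair] at h1
      refine le_trans (le_of_eq ?_) h1
      simp only [hφapp, ContinuousLinearMap.comp_apply, u, A', B', lpMap_single, lpMap_apply]
      rfl)
  have hXt : ‖X‖ ≤ t := by
    refine hX.trans ?_
    rw [mul_div_assoc', div_le_iff₀ (by positivity)]
    nlinarith
  have hAB : ‖A'‖ * ‖B'‖ ≤ Λ * (Cr + t) := by
    calc ‖A'‖ * ‖B'‖ ≤ √(Cr + t) * (Λ * √(Cr + t)) := by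
          gcongr
          · exact norm_lpMap_le _ _ _
          · exact norm_lpMap_le _ _ _
      _ = Λ * (√(Cr + t) * √(Cr + t)) := by ring
      _ = _ := by rw [Real.mul_self_sqrt (by linarith)]
  obtain ⟨d, m, hd, hm, hDd⟩ := exists_strictMono_rows_diagonal b (B' ∘L T ∘L A' - X)
    (fun i j k l h => by
      have h1 := hXd (Nat.pair i j) (Nat.pair k l) (fun h1 => h (by
        have := Nat.pair_eq_pair.1 h1
        rw [this.1, this.2]))
      simpa only [hφapp, u, Nat.unpair_pair] using h1)
  obtain ⟨e, he, hem, hPQ⟩ := exists_strictMono_forall_or hm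
    (P := fun n => FactorsThrough (ContinuousLinearMap.id ℝ E) (d n) (C + t))
    (Q := fun n => FactorsThrough (ContinuousLinearMap.id ℝ E)
      (ContinuousLinearMap.id ℝ E - d n) (C + t))
    (fun n => (hdiag (d n) (hd n)).imp (fun h => h t ht) (fun h => h t ht))
  have hpush : ∀ z i, (B' ∘L T ∘L A' - X) (lpPush e he.injective z) (e i) = d (e i) (z i) := by
    intro z i
    rw [hDd _ (fun n hn => lpPush_apply_of_notMem _ _ _ fun h => hn (hem h)), lpPush_apply]
  rcases hPQ with h | h
  · obtain ⟨R, S, hRS, h⟩ := exists_factorization_of_rows _ he.injective _ hpush h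
    exact ⟨A', B', X, R, S, hBA', hAB, hXt, hRS, .inl h⟩
  · obtain ⟨R, S, hRS, h⟩ := exists_factorization_of_rows
      (ContinuousLinearMap.id ℝ _ - (B' ∘L T ∘L A' - X)) he.injective
      (fun i => ContinuousLinearMap.id ℝ E - d (e i)) (fun z i => by
        have h1 := hpush z i
        have h2 := lpPush_apply e he.injective z i
        rw [_root_.sub_apply, lp.coeFn_sub, Pi.sub_apply, h1, ContinuousLinearMap.id_apply, h2]
        rfl) h
    exact ⟨A', B', X, R, S, hBA', hAB, hXt, hRS, .inr h⟩

end Reduction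

/-! ### Pełczyński decomposition and primariness -/

section Decomposition

theorem nontrivial_lp {X : Type*} [NormedAddCommGroup X] [Nontrivial X] {p : ℝ≥0∞} : Nontrivial (lp (fun _ : ℕ => X) p) := by
  obtain ⟨x, hx⟩ := exists_ne (0 : X)
  refine ⟨lp.single p 0 x, 0, fun h => hx ?_⟩
  have := congrArg (fun w : lp (fun _ : ℕ => X) p => w 0) h
  simpa using this

theorem memℓp_uncurry {X : Type*} [NormedAddCommGroup X] {p : ℝ≥0∞} [Fact (1 ≤ p)]
    (w : lp (fun _ : ℕ => lp (fun _ : ℕ => X) p) p) :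
    Memℓp (fun n : ℕ => w n.unpair.1 n.unpair.2) p := by
  rcases eq_or_ne p ∞ with rfl | h
  · refine memℓp_infty ⟨‖w‖, ?_⟩
    rintro _ ⟨n, rfl⟩
    exact (lp.norm_apply_le_norm (exponent_ne_zero _) _ _).trans
      (lp.norm_apply_le_norm (exponent_ne_zero _) w _)
  · have hp' := exponent_toReal_pos (p := p) h
    refine memℓp_gen ?_
    rw [← Nat.pairEquiv.summable_iff]
    refine (summable_prod_of_nonneg (fun _ => by simp only [Pi.zero_apply, Function.comp]; positivity)).2
      ⟨fun i => ?_, ?_⟩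
    · simpa using (lp.memℓp (w i)).summable hp'
    · have h1 := (lp.memℓp w).summable hp'
      simpa [lp.norm_rpow_eq_tsum hp'] using h1

variable {X Y : Type*} [NormedAddCommGroup X] [NormedSpace ℝ X] [NormedAddCommGroup Y]
  [NormedSpace ℝ Y] {p : ℝ≥0∞} [hp : Fact (1 ≤ p)]

theorem pair_injective (i : ℕ) : (fun j => Nat.pair i j).Injective := fun _ _ h =>
  (Nat.pair_eq_pair.1 h).2

/-- Fubini: the sum of `‖z n‖ ^ p` is grouped by the first component of the pairing. -/
theorem hasSum_norm_lpPull_rpow (h : p ≠ ∞) (z : lp (fun _ : ℕ => X) p) :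
    HasSum (fun i => ‖(lpPull (fun j => Nat.pair i j) (pair_injective i) z)‖ ^ p.toReal)
      (‖z‖ ^ p.toReal) := by
  have hp' := exponent_toReal_pos h
  have h1 := Nat.pairEquiv.hasSum_iff.2 (lp.hasSum_norm hp' z)
  exact h1.prod_fiberwise fun i => lp.hasSum_norm hp'
    (lpPull (fun j => Nat.pair i j) (pair_injective i) z)

theorem memℓp_curry (z : lp (fun _ : ℕ => X) p) :
    Memℓp (fun i => lpPull (fun j => Nat.pair i j) (pair_injective i) z) p := by
  rcases eq_or_ne p ∞ with rfl | h
  · refine memℓp_infty ⟨‖z‖, ?_⟩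
    rintro _ ⟨i, rfl⟩
    exact lp.norm_le_of_forall_le (norm_nonneg _)
      fun j => lp.norm_apply_le_norm (exponent_ne_zero _) z _
  · exact memℓp_gen (hasSum_norm_lpPull_rpow h z).summable

/-- An `ℓ^p` sum of `ℓ^p` sums is an `ℓ^p` sum. -/
noncomputable def lpCurry :
    lp (fun _ : ℕ => X) p ≃ₗᵢ[ℝ] lp (fun _ : ℕ => lp (fun _ : ℕ => X) p) p where
  toFun z := ⟨fun i => lpPull (fun j => Nat.pair i j) (pair_injective i) z, memℓp_curry z⟩
  invFun w := ⟨fun n => w n.unpair.1 n.unpair.2, memℓp_uncurry w⟩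
  map_add' _ _ := rfl
  map_smul' _ _ := rfl
  left_inv z := lp.ext (funext fun n => congrArg z (Nat.pair_unpair n))
  right_inv w := lp.ext (funext fun i => lp.ext (funext fun j => by
    change w (Nat.pair i j).unpair.1 (Nat.pair i j).unpair.2 = w i j
    rw [Nat.unpair_pair]))
  norm_map' z := by
    rcases eq_or_ne p ∞ with rfl | h
    · refine le_antisymm (lp.norm_le_of_forall_le (norm_nonneg _) fun i =>
        lp.norm_le_of_forall_le (norm_nonneg _)
          fun j => lp.norm_apply_le_norm (exponent_ne_zero _) z _)
        (lp.norm_le_of_forall_le (norm_nonneg _) fun n => ?_)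
      set w : lp (fun _ : ℕ => lp (fun _ : ℕ => X) ∞) ∞ :=
        ⟨fun i => lpPull (fun j => Nat.pair i j) (pair_injective i) z, memℓp_curry z⟩
      have h1 : z n = w n.unpair.1 n.unpair.2 := (congrArg z (Nat.pair_unpair n)).symm
      rw [h1]
      exact (lp.norm_apply_le_norm (exponent_ne_zero _) _ _).trans
        (lp.norm_apply_le_norm (exponent_ne_zero _) w _)
    · have hp' := exponent_toReal_pos (p := p) h
      refine (Real.rpow_left_inj (norm_nonneg _) (norm_nonneg _) hp'.ne').1 ?_
      exact (lp.hasSum_norm hp' (⟨_, memℓp_curry z⟩ :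
        lp (fun _ : ℕ => lp (fun _ : ℕ => X) p) p)).unique (hasSum_norm_lpPull_rpow h z)

/-- The `ℓ^p` sums of isomorphic spaces are isomorphic. -/
noncomputable def lpCongr (e : X ≃L[ℝ] Y) :
    lp (fun _ : ℕ => X) p ≃L[ℝ] lp (fun _ : ℕ => Y) p :=
  ContinuousLinearEquiv.equivOfInverse
    (lpMap (fun _ => (e : X →L[ℝ] Y)) _ (fun _ => le_rfl))
    (lpMap (fun _ => (e.symm : Y →L[ℝ] X)) _ (fun _ => le_rfl))
    (fun z => lp.ext (funext fun i => e.symm_apply_apply (z i)))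
    (fun z => lp.ext (funext fun i => e.apply_symm_apply (z i)))

/-- The `ℓ^p` sum of a product is the product of the `ℓ^p` sums. -/
noncomputable def lpProd :
    lp (fun _ : ℕ => X × Y) p ≃L[ℝ] lp (fun _ : ℕ => X) p × lp (fun _ : ℕ => Y) p :=
  ContinuousLinearEquiv.equivOfInverse
    ((lpMap (fun _ => ContinuousLinearMap.fst ℝ X Y) _ (fun _ => le_rfl)).prod
      (lpMap (fun _ => ContinuousLinearMap.snd ℝ X Y) _ (fun _ => le_rfl)))
    ((lpMap (fun _ => ContinuousLinearMap.inl ℝ X Y) _ (fun _ => le_rfl)).coprod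
      (lpMap (fun _ => ContinuousLinearMap.inr ℝ X Y) _ (fun _ => le_rfl)))
    (fun z => lp.ext (funext fun i => by
      change ((z i).1, (0 : Y)) + ((0 : X), (z i).2) = z i
      simp))
    (fun z => Prod.ext
      (lp.ext (funext fun i => by
        change (((z.1 i), (0 : Y)) + ((0 : X), (z.2 i))).1 = z.1 i
        simp))
      (lp.ext (funext fun i => by
        change (((z.1 i), (0 : Y)) + ((0 : X), (z.2 i))).2 = z.2 i
        simp)))

/-- Splitting off the first coordinate of an `ℓ^p` sum. -/
noncomputable def lpSucc :
    lp (fun _ : ℕ => X) p ≃L[ℝ] X × lp (fun _ : ℕ => X) p :=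
  ContinuousLinearEquiv.equivOfInverse
    ((lp.evalCLM ℝ (fun _ : ℕ => X) p 0).prod (lpPull Nat.succ Nat.succ_injective))
    ((lp.singleContinuousLinearMap ℝ (fun _ : ℕ => X) p 0).coprod
      (lpPush Nat.succ Nat.succ_injective))
    (fun z => lp.ext (funext fun i => by
      change (lp.single p 0 (z 0) : lp (fun _ : ℕ => X) p) i +
        lpPush Nat.succ Nat.succ_injective (lpPull Nat.succ Nat.succ_injective z) i = z i
      cases i with
      | zero =>
        rw [lp.single_apply_self, lpPush_apply_of_notMem _ _ _ (by simp), add_zero]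
      | succ i =>
        rw [lp.single_apply_ne _ _ _ (by simp), zero_add, ← Nat.succ_eq_add_one, lpPush_apply,
          lpPull_apply]))
    (fun z => Prod.ext
      (by
        change (lp.single p 0 z.1 : lp (fun _ : ℕ => X) p) 0 + lpPush Nat.succ Nat.succ_injective z.2 0 = z.1
        rw [lp.single_apply_self, lpPush_apply_of_notMem _ _ _ (by simp), add_zero])
      (lp.ext (funext fun i => by
        change (lp.single p 0 z.1 : lp (fun _ : ℕ => X) p) i.succ + lpPush Nat.succ Nat.succ_injective z.2 i.succ = z.2 i
        rw [lp.single_apply_ne _ _ _ (by simp), zero_add, lpPush_apply])))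

/-- Pełczyński's decomposition method: a complemented subspace of an `ℓ^p` sum `Z` which contains a
complemented copy of `Z` is isomorphic to `Z`. -/
theorem nonempty_equiv_of_complemented
    {F G : Submodule ℝ (lp (fun _ : ℕ => X) p)} (hFG : Submodule.IsTopCompl F G)
    (A : F →L[ℝ] lp (fun _ : ℕ => X) p) (B : lp (fun _ : ℕ => X) p →L[ℝ] F)
    (hAB : ∀ z, A (B z) = z) : Nonempty (F ≃L[ℝ] lp (fun _ : ℕ => X) p) := by
  -- `F` is isomorphic to `Z × ker A`, because `B` is a right inverse of `A`.
  let e₁ := ContinuousLinearEquiv.equivOfRightInverse A B hAB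
  let e₂ : (lp (fun _ : ℕ => X) p) ≃L[ℝ] F × G :=
    (Submodule.prodEquivOfIsTopCompl F G hFG).symm
  let e₃ : lp (fun _ : ℕ => X) p ≃L[ℝ] lp (fun _ : ℕ => lp (fun _ : ℕ => X) p) p :=
    lpCurry.toContinuousLinearEquiv
  -- `Z` is isomorphic to `Z × Z`
  let e₄ : lp (fun _ : ℕ => X) p ≃L[ℝ] lp (fun _ : ℕ => X) p × lp (fun _ : ℕ => X) p :=
    e₃.trans (lpSucc.trans ((ContinuousLinearEquiv.refl ℝ _).prodCongr e₃.symm))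
  -- `Z` is isomorphic to `ℓ^p(F) × ℓ^p(G)`
  let e₅ : lp (fun _ : ℕ => X) p ≃L[ℝ] lp (fun _ : ℕ => F) p × lp (fun _ : ℕ => G) p :=
    e₃.trans ((lpCongr e₂).trans lpProd)
  -- `Z` is isomorphic to `F × Z`
  let e₆ : lp (fun _ : ℕ => X) p ≃L[ℝ] F × lp (fun _ : ℕ => X) p :=
    e₅.trans ((lpSucc.prodCongr (ContinuousLinearEquiv.refl ℝ _)).trans
      ((ContinuousLinearEquiv.prodAssoc ℝ _ _ _).trans
        ((ContinuousLinearEquiv.refl ℝ _).prodCongr e₅.symm)))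
  -- `F` is isomorphic to `Z × F`
  let e₇ : F ≃L[ℝ] lp (fun _ : ℕ => X) p × F :=
    e₁.trans ((e₄.prodCongr (ContinuousLinearEquiv.refl ℝ _)).trans
      ((ContinuousLinearEquiv.prodAssoc ℝ _ _ _).trans
        ((ContinuousLinearEquiv.refl ℝ _).prodCongr e₁.symm)))
  exact ⟨e₇.trans ((ContinuousLinearEquiv.prodComm ℝ _ _).trans e₆.symm)⟩

/-- The `ℓ^p` sums with a primary factorization property are primary. -/
theorem HasPrimaryFactorization.isPrimarySpace_lp [CompleteSpace X] {K : ℝ}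
    (h : HasPrimaryFactorization (lp (fun _ : ℕ => X) p) K) :
    IsPrimarySpace (lp (fun _ : ℕ => X) p) := by
  intro F G hF hG hcompl
  have hFG : Submodule.IsTopCompl F G := Submodule.IsCompl.isTopCompl_of_isClosed hcompl hF hG
  let e := (Submodule.prodEquivOfIsTopCompl F G hFG).symm
  let PF : lp (fun _ : ℕ => X) p →L[ℝ] F := ContinuousLinearMap.fst ℝ F G ∘L e
  let PG : lp (fun _ : ℕ => X) p →L[ℝ] G := ContinuousLinearMap.snd ℝ F G ∘L e
  have hsum : ∀ z, (PF z : lp (fun _ : ℕ => X) p) + PG z = z := fun z =>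
    (Submodule.prodEquivOfIsTopCompl F G hFG).apply_symm_apply z
  -- If `I` factors through the projection onto `F`, then it factors through the space `F`, which
  -- thus contains a complemented copy of `Z`; the complementary projection does the same for `G`.
  rcases h (F.subtypeL ∘L PF) with h | h
  · obtain ⟨A, B, -, h⟩ := h 1 one_pos
    exact .inl (nonempty_equiv_of_complemented hFG (A ∘L F.subtypeL) (PF ∘L B)
      fun z => (congrArg (fun f : lp (fun _ : ℕ => X) p →L[ℝ] lp (fun _ : ℕ => X) p => f z)
        h).symm)
  · obtain ⟨A, B, -, h⟩ := h 1 one_pos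
    have hPG : ContinuousLinearMap.id ℝ _ - F.subtypeL ∘L PF = G.subtypeL ∘L PG :=
      ContinuousLinearMap.ext fun z => sub_eq_of_eq_add' (hsum z).symm
    rw [hPG] at h
    exact .inr (nonempty_equiv_of_complemented hFG.symm (A ∘L G.subtypeL) (PG ∘L B)
      fun z => (congrArg (fun f : lp (fun _ : ℕ => X) p →L[ℝ] lp (fun _ : ℕ => X) p => f z)
        h).symm)

end Decomposition

end StratRep

/-! ### The theorem for `E` and its `ℓ^p` sums -/

open StratRep
theorem theorem11p1 {E : Type*} [NormedAddCommGroup E] [NormedSpace ℝ E] [CompleteSpace E]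
    (b : SchauderBasis ℝ E) (hnorm : ∀ j, ‖b j‖ = 1)
    (lam : ℝ) (hlam : (b.nnnormProjBound : ℝ) = lam)
    (Cr C : ℝ) (hCr : 1 ≤ Cr) (hC : 1 ≤ C)
    (hrep : IsStrategicallyReproducibleProj b Cr)
    (hdiag : HasPrimaryDiagonalFactorization b C) :
    (HasPrimaryFactorization E (lam * Cr * C) ∧
      NonFactorSetIsUniqueMaximalIdeal E) ∧
    (∀ (p : ℝ≥0∞) [Fact (1 ≤ p)], p ≠ ∞ →
      HasPrimaryFactorization (lp (fun _ : ℕ => E) p) (lam * Cr * C) ∧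
      NonFactorSetIsUniqueMaximalIdeal (lp (fun _ : ℕ => E) p) ∧
      IsPrimarySpace (lp (fun _ : ℕ => E) p)) ∧
    (IsAsymptoticallyCurved b →
      HasPrimaryFactorization (lp (fun _ : ℕ => E) ∞) (lam * Cr * C) ∧
      NonFactorSetIsUniqueMaximalIdeal (lp (fun _ : ℕ => E) ∞) ∧
      IsPrimarySpace (lp (fun _ : ℕ => E) ∞)) := by
  have : Nontrivial E := ⟨b 0, 0, by rw [← norm_ne_zero_iff, hnorm]; exact one_ne_zero⟩
  subst hlam
  have hCr0 : 0 ≤ Cr := zero_le_one.trans hCr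
  have hE := hasPrimaryFactorization_of_strategicallyReproducible b hnorm hCr0 hrep hdiag
  have hlp : ∀ (p : ℝ≥0∞) [Fact (1 ≤ p)],
      HasPrimaryFactorization (lp (fun _ : ℕ => E) p) (b.nnnormProjBound * Cr * C) ∧
      NonFactorSetIsUniqueMaximalIdeal (lp (fun _ : ℕ => E) p) ∧
      IsPrimarySpace (lp (fun _ : ℕ => E) p) := by
    intro p _
    have hZ := hasPrimaryFactorization_lp_of_strategicallyReproducible (p := p) b hnorm hCr0 hrep
      hdiag
    have := nontrivial_lp (X := E) (p := p)
    exact ⟨hZ, hZ.nonFactorSetIsUniqueMaximalIdeal, hZ.isPrimarySpace_lp⟩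
  exact ⟨⟨hE, hE.nonFactorSetIsUniqueMaximalIdeal⟩, fun p _ _ => hlp p, fun _ => hlp ∞⟩
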